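/- Let $(M,g)$ be a finite-dimensional smooth Riemannian manifold (Hausdorff, second countable, without boundary) with Levi-Civita connection $\nabla$. The rolling connection of $M$ rolling on the unit sphere is the connection $\nabla^{\rm R}$ on the vector bundle $TM\oplus\mathbb R\to M$ given, for a section $(X,r)$ and a tangent vector $Y\in T_xM$, by $$\nabla^{\rm R}_Y(X,r)=\big(\nabla_YX+r(x)\,Y,\; Y(r)-g(X_x,Y)\big).$$ Let $C(M)=M\times(0,\infty)$ be the Riemannian cone over $M$, with the metric $\tilde g=s^2g+ds^2$ (where $s$ is the coordinate on $(0,\infty)$) and Levi-Civita connection $\tilde\nabla$. Fix $k\in\{1,2,\dots\}\cup\{\infty\}$. For a connection $D$ on a vector bundle, let $P^{D}(\gamma)$ denote the parallel transport from time $0$ to time $1$ along a curve $\gamma$ defined on $[0,1]$, and let the holonomy group $H^{D}|_x$ be the group of all linear automorphisms of the fibre over $x$ of the form $P^{D}(\gamma)$, where $\gamma$ is a (continuous) piecewise $C^k$ loop based at $x$. For $(x,s)\in C(M)$ define the linear isomorphism $$\mathcal I_{(x,s)}\colon T_{(x,s)}C(M)\to T_xM\times\mathbb R,\qquad X+b\,\partial_s\mapsto(sX,b)\qquad(X\in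 T_xM,\ b\in\mathbb R).$$ Then for every $(x,s)\in C(M)$: 1. $A\mapsto\mathcal I_{(x,s)}\circ A\circ\mathcal I_{(x,s)}^{-1}$ is a group isomorphism from the Riemannian holonomy group $H^{\tilde\nabla}|_{(x,s)}$ of the cone onto the rolling holonomy group $H^{\nabla^{\rm R}}|_x$. 2. For every piecewise $C^k$ loop $\Gamma=(\gamma,a)$ in $C(M)$ based at $(x,s)$, the parallel transports of $\tilde\nabla$ along $\Gamma$ and of $\nabla^{\rm R}$ along $\gamma$ exist, are linear isomorphisms, and satisfy $$\mathcal I_{(x,s)}\circ P^{\tilde\nabla}(\Gamma)=P^{\nabla^{\rm R}}(\gamma)\circ\mathcal I_{(x,s)}.$$ -/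

import Mathlib

open Bundle Set
open scoped Manifold ContDiff Topology

noncomputable section

section LeviCivita

variable {E : Type*} [NormedAddCommGroup E] [NormedSpace ℝ E]
  {H : Type*} [TopologicalSpace H] {I : ModelWithCorners ℝ E H}
  {M : Type*} [TopologicalSpace M] [ChartedSpace H M] [IsManifold I ∞ M]

/-- Smooth Riemannian metrics on the manifold `M`. -/
abbrev SmoothMetric (I : ModelWithCorners ℝ E H) (M : Type*) [TopologicalSpace M]
    [ChartedSpace H M] [IsManifold I ∞ M] : Type _ :=
  ContMDiffRiemannianMetric I ∞ E (fun x : M ↦ TangentSpace I x)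

namespace SmoothMetric

/-- The function `y ↦ g_y(X_y, Y_y)` for two vector fields. -/
def pair (g : SmoothMetric I M) (X Y : Π x : M, TangentSpace I x) : M → ℝ :=
  fun y ↦ g.inner y (X y) (Y y)

lemma inner_self_nonneg (g : SmoothMetric I M) {x : M} (v : TangentSpace I x) :
    0 ≤ g.inner x v v := by
  by_cases h : v = 0
  · simp [h]
  · exact (g.pos x v h).le

lemma inner_smul_smul (g : SmoothMetric I M) {x : M} (c : ℝ) (v : TangentSpace I x) :
    g.inner x (c • v) (c • v) = c ^ 2 * g.inner x v v := by
  simp only [map_smul, smul_apply, smul_eq_mul]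
  ring

lemma mdifferentiableAt_pair (g : SmoothMetric I M) {X Y : Π x : M, TangentSpace I x} {x : M}
    (hX : MDiffAt (T% X) x) (hY : MDiffAt (T% Y) x) : MDiffAt (g.pair X Y) x := by
  have h := (g.contMDiff x).mdifferentiableAt (by simp)
  have := MDifferentiableAt.clm_bundle_apply₂ (E₃ := Bundle.Trivial M ℝ) (F₃ := ℝ)
    (b := fun m : M ↦ m) h hX hY
  rw [mdifferentiableAt_totalSpace] at this
  exact this.2

open VectorField in
/-- The right-hand side of the Koszul formula for `2 g(∇_X Y, Z)` at `x`. -/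
def koszul (g : SmoothMetric I M) (X Y Z : Π x : M, TangentSpace I x) (x : M) : ℝ :=
  mvfderiv I (g.pair Y Z) x (X x) + mvfderiv I (g.pair X Z) x (Y x)
    - mvfderiv I (g.pair X Y) x (Z x)
    + g.inner x (mlieBracket I X Y x) (Z x) - g.inner x (mlieBracket I X Z x) (Y x)
    - g.inner x (mlieBracket I Y Z x) (X x)


section
variable (g : SmoothMetric I M) {X X' Y Y' Z Z' : Π x : M, TangentSpace I x} {x : M} {f : M → ℝ}

lemma pair_comm : g.pair X Y = g.pair Y X := funext fun y ↦ g.symm y _ _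

lemma mvfderiv_pair_add_left (hX : MDiffAt (T% X) x) (hX' : MDiffAt (T% X') x)
    (hY : MDiffAt (T% Y) x) :
    mvfderiv I (g.pair (X + X') Y) x = mvfderiv I (g.pair X Y) x + mvfderiv I (g.pair X' Y) x := by
  rw [← mvfderiv_fun_add (g.mdifferentiableAt_pair hX hY) (g.mdifferentiableAt_pair hX' hY)]
  congr 1
  ext y
  simp [pair]

lemma mvfderiv_pair_smul_left (hf : MDiffAt f x) (hX : MDiffAt (T% X) x)
    (hY : MDiffAt (T% Y) x) :
    mvfderiv I (g.pair (f • X) Y) x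
      = f x • mvfderiv I (g.pair X Y) x + g.inner x (X x) (Y x) • mvfderiv I f x := by
  have : g.pair (f • X) Y = fun y ↦ f y * g.pair X Y y := by
    ext y
    simp [pair]
  rw [this, mvfderiv_fun_mul hf (g.mdifferentiableAt_pair hX hY)]
  rfl

variable [FiniteDimensional ℝ E]

open VectorField

lemma koszul_add₁ (hX : MDiffAt (T% X) x) (hX' : MDiffAt (T% X') x)
    (hY : MDiffAt (T% Y) x) (hZ : MDiffAt (T% Z) x) :
    g.koszul (X + X') Y Z x = g.koszul X Y Z x + g.koszul X' Y Z x := by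
  have : CompleteSpace E := FiniteDimensional.complete ℝ E
  simp only [koszul, g.mvfderiv_pair_add_left hX hX' hZ, g.mvfderiv_pair_add_left hX hX' hY,
    mlieBracket_add_left hX hX', Pi.add_apply, map_add, add_apply]
  ring

lemma koszul_smul₁ (hf : MDiffAt f x) (hX : MDiffAt (T% X) x)
    (hY : MDiffAt (T% Y) x) (hZ : MDiffAt (T% Z) x) :
    g.koszul (f • X) Y Z x = f x * g.koszul X Y Z x := by
  have : CompleteSpace E := FiniteDimensional.complete ℝ E
  simp only [koszul, g.mvfderiv_pair_smul_left hf hX hZ, g.mvfderiv_pair_smul_left hf hX hY,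
    mlieBracket_smul_left hf hX, Pi.smul_apply', map_add, map_smul, add_apply,
    smul_apply, smul_eq_mul]
  ring

lemma koszul_add₂ (hX : MDiffAt (T% X) x) (hY : MDiffAt (T% Y) x) (hY' : MDiffAt (T% Y') x)
    (hZ : MDiffAt (T% Z) x) :
    g.koszul X (Y + Y') Z x = g.koszul X Y Z x + g.koszul X Y' Z x := by
  have : CompleteSpace E := FiniteDimensional.complete ℝ E
  simp only [koszul, g.mvfderiv_pair_add_left hY hY' hZ, g.pair_comm (X := X) (Y := Y + Y'),
    g.mvfderiv_pair_add_left hY hY' hX, g.pair_comm (X := Y) (Y := X),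
    g.pair_comm (X := Y') (Y := X),
    mlieBracket_add_left hY hY', mlieBracket_add_right hY hY',
    Pi.add_apply, map_add, add_apply]
  ring

lemma koszul_smul₂ (hf : MDiffAt f x) (hX : MDiffAt (T% X) x)
    (hY : MDiffAt (T% Y) x) (hZ : MDiffAt (T% Z) x) :
    g.koszul X (f • Y) Z x
      = f x * g.koszul X Y Z x + 2 * (mvfderiv I f x (X x) * g.inner x (Y x) (Z x)) := by
  have : CompleteSpace E := FiniteDimensional.complete ℝ E
  simp only [koszul, g.mvfderiv_pair_smul_left hf hY hZ, g.pair_comm (X := X) (Y := f • Y),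
    g.mvfderiv_pair_smul_left hf hY hX, g.pair_comm (X := Y) (Y := X),
    mlieBracket_smul_left hf hY, mlieBracket_smul_right hf hY,
    Pi.smul_apply', map_add, map_smul, add_apply,
    smul_apply, smul_eq_mul]
  rw [g.symm x (Y x) (X x)]
  ring

lemma koszul_add₃ (hX : MDiffAt (T% X) x) (hY : MDiffAt (T% Y) x)
    (hZ : MDiffAt (T% Z) x) (hZ' : MDiffAt (T% Z') x) :
    g.koszul X Y (Z + Z') x = g.koszul X Y Z x + g.koszul X Y Z' x := by
  have : CompleteSpace E := FiniteDimensional.complete ℝ E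
  simp only [koszul, g.pair_comm (Y := Z + Z'), g.mvfderiv_pair_add_left hZ hZ' hX,
    g.mvfderiv_pair_add_left hZ hZ' hY, g.pair_comm (X := Z), g.pair_comm (X := Z'),
    mlieBracket_add_right hZ hZ', Pi.add_apply, map_add, add_apply]
  ring

lemma koszul_smul₃ (hf : MDiffAt f x) (hX : MDiffAt (T% X) x)
    (hY : MDiffAt (T% Y) x) (hZ : MDiffAt (T% Z) x) :
    g.koszul X Y (f • Z) x = f x * g.koszul X Y Z x := by
  have : CompleteSpace E := FiniteDimensional.complete ℝ E
  simp only [koszul, g.pair_comm (Y := f • Z), g.mvfderiv_pair_smul_left hf hZ hX,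
    g.mvfderiv_pair_smul_left hf hZ hY, g.pair_comm (X := Z),
    mlieBracket_smul_right hf hZ, Pi.smul_apply', map_add, map_smul,
    add_apply, smul_apply, smul_eq_mul]
  rw [g.symm x (Z x) (X x), g.symm x (Z x) (Y x)]
  ring

/-- For `Y` differentiable at `x`, the bilinear form `(u, w) ↦ 2 g(∇_u Y, w)` on `T_x M`. -/
def koszulForm (hY : MDiffAt (T% Y) x) :
    TangentSpace I x →L[ℝ] TangentSpace I x →L[ℝ] ℝ :=
  TensorialAt.mkHom₂ (I := I) (F := E) (F' := E) (fun X Z ↦ g.koszul X Y Z x) x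
    (fun _ hZ ↦ ⟨fun hf hX ↦ g.koszul_smul₁ hf hX hY hZ,
      fun hX hX' ↦ g.koszul_add₁ hX hX' hY hZ⟩)
    (fun _ hX ↦ ⟨fun hf hZ ↦ g.koszul_smul₃ hf hX hY hZ,
      fun hZ hZ' ↦ g.koszul_add₃ hX hY hZ hZ'⟩)

lemma koszulForm_apply (hX : MDiffAt (T% X) x) (hY : MDiffAt (T% Y) x) (hZ : MDiffAt (T% Z) x) :
    g.koszulForm hY (X x) (Z x) = g.koszul X Y Z x :=
  TensorialAt.mkHom₂_apply (I := I) (F := E) (F' := E) _ _ hX hZ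

end

variable [FiniteDimensional ℝ E]

/-- The musical isomorphism `T_x M ≃ T_x^* M`, `u ↦ g_x(u, ·)`. -/
def flat (g : SmoothMetric I M) (x : M) :
    TangentSpace I x ≃ₗ[ℝ] (TangentSpace I x →L[ℝ] ℝ) :=
  have : FiniteDimensional ℝ (TangentSpace I x) := inferInstanceAs (FiniteDimensional ℝ E)
  have : T2Space (TangentSpace I x) := inferInstanceAs (T2Space E)
  have h : Function.Injective (g.inner x).toLinearMap := by
    rw [injective_iff_map_eq_zero]
    intro v hv
    by_contra h0
    have := g.pos x v h0
    have hv' : g.inner x v = 0 := hv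
    simp [hv'] at this
  have hfr : Module.finrank ℝ (TangentSpace I x) = Module.finrank ℝ (TangentSpace I x →L[ℝ] ℝ) := by
    rw [← (LinearMap.toContinuousLinearMap (𝕜 := ℝ) (E := TangentSpace I x)
      (F' := ℝ)).finrank_eq]
    exact (Subspace.dual_finrank_eq (K := ℝ) (V := TangentSpace I x)).symm
  have : FiniteDimensional ℝ (TangentSpace I x →L[ℝ] ℝ) :=
    (LinearMap.toContinuousLinearMap (𝕜 := ℝ) (E := TangentSpace I x)
      (F' := ℝ)).finiteDimensional
  LinearEquiv.ofBijective (g.inner x).toLinearMap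
    ⟨h, (LinearMap.injective_iff_surjective_of_finrank_eq_finrank hfr).1 h⟩

@[simp] lemma flat_apply (g : SmoothMetric I M) (x : M) (u : TangentSpace I x) :
    g.flat x u = g.inner x u := rfl

lemma inner_flat_symm (g : SmoothMetric I M) (x : M) (φ : TangentSpace I x →L[ℝ] ℝ) :
    g.inner x ((g.flat x).symm φ) = φ := (g.flat x).apply_symm_apply φ

lemma eq_of_inner_eq (g : SmoothMetric I M) {x : M} {u v : TangentSpace I x}
    (h : ∀ w, g.inner x u w = g.inner x v w) : u = v :=
  (g.flat x).injective (ContinuousLinearMap.ext h)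

open Classical in
/-- The map underlying the Levi-Civita connection: at a point `x` where `Y` is differentiable,
`u ↦ ∇_u Y` is given by the Koszul formula. (At points where `Y` is not differentiable the value
is irrelevant, and set to `0`.) -/
def leviCivitaAux (g : SmoothMetric I M) (Y : Π x : M, TangentSpace I x) (x : M) :
    TangentSpace I x →L[ℝ] TangentSpace I x :=
  have : FiniteDimensional ℝ (TangentSpace I x) := inferInstanceAs (FiniteDimensional ℝ E)
  have : T2Space (TangentSpace I x) := inferInstanceAs (T2Space E)
  if hY : MDifferentiableAt I (I.prod 𝓘(ℝ, E)) (fun y ↦ TotalSpace.mk' E y (Y y)) x then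
    LinearMap.toContinuousLinearMap
      ((g.flat x).symm.toLinearMap ∘ₗ ((1 / 2 : ℝ) • g.koszulForm hY).toLinearMap)
  else 0

/-- The Koszul formula. -/
lemma inner_leviCivitaAux (g : SmoothMetric I M) {X Y Z : Π x : M, TangentSpace I x} {x : M}
    (hX : MDiffAt (T% X) x) (hY : MDiffAt (T% Y) x) (hZ : MDiffAt (T% Z) x) :
    g.inner x (g.leviCivitaAux Y x (X x)) (Z x) = 1 / 2 * g.koszul X Y Z x := by
  rw [leviCivitaAux, dif_pos hY, ← g.koszulForm_apply hX hY hZ]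
  change g.inner x ((g.flat x).symm ((1 / 2 : ℝ) • g.koszulForm hY (X x))) (Z x) = _
  rw [inner_flat_symm]
  rfl

lemma leviCivitaAux_ext (g : SmoothMetric I M) {x : M} {A B : TangentSpace I x →L[ℝ] TangentSpace I x}
    (h : ∀ X Z : Π x : M, TangentSpace I x, MDiffAt (T% X) x → MDiffAt (T% Z) x →
      g.inner x (A (X x)) (Z x) = g.inner x (B (X x)) (Z x)) : A = B := by
  ext u
  refine g.eq_of_inner_eq fun w ↦ ?_
  have := h (FiberBundle.extend E u) (FiberBundle.extend E w)
    (FiberBundle.mdifferentiableAt_extend ..) (FiberBundle.mdifferentiableAt_extend ..)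
  simpa using this

/-- The Levi-Civita connection of a Riemannian metric, defined by the Koszul formula. -/
def leviCivita (g : SmoothMetric I M) :
    CovariantDerivative I E (fun x : M ↦ TangentSpace I x) where
  toFun := g.leviCivitaAux
  isCovariantDerivativeOnUniv :=
    { add := by
        intro Y Y' x hY hY' _
        refine g.leviCivitaAux_ext fun X Z hX hZ ↦ ?_
        rw [g.inner_leviCivitaAux hX (mdifferentiableAt_add_section hY hY') hZ,
          add_apply, map_add, add_apply, g.inner_leviCivitaAux hX hY hZ,
          g.inner_leviCivitaAux hX hY' hZ, g.koszul_add₂ hX hY hY' hZ]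
        ring
      leibniz := by
        intro Y f x hY hf _
        refine g.leviCivitaAux_ext fun X Z hX hZ ↦ ?_
        rw [g.inner_leviCivitaAux hX (hf.smul_section hY) hZ, g.koszul_smul₂ hf hX hY hZ,
          add_apply, map_add, add_apply, smul_apply, map_smul, smul_apply,
          g.inner_leviCivitaAux hX hY hZ]
        simp
        ring }

lemma inner_leviCivita (g : SmoothMetric I M) {X Y Z : Π x : M, TangentSpace I x} {x : M}
    (hX : MDiffAt (T% X) x) (hY : MDiffAt (T% Y) x) (hZ : MDiffAt (T% Z) x) :
    g.inner x (g.leviCivita Y x (X x)) (Z x) = 1 / 2 * g.koszul X Y Z x :=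
  g.inner_leviCivitaAux hX hY hZ

/-- The Levi-Civita connection is torsion free. -/
theorem torsion_leviCivita [CompleteSpace E] (g : SmoothMetric I M) :
    g.leviCivita.torsion = 0 := by
  rw [CovariantDerivative.torsion_eq_zero_iff]
  intro X Y x hX hY
  refine g.eq_of_inner_eq fun w ↦ ?_
  have hZ := FiberBundle.mdifferentiableAt_extend I E w
  have h1 := g.inner_leviCivita hX hY hZ
  have h2 := g.inner_leviCivita hY hX hZ
  rw [FiberBundle.extend_apply_self] at h1 h2
  rw [map_sub, sub_apply, h1, h2, koszul, koszul, VectorField.mlieBracket_swap_apply (V := Y) (W := X),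
    g.pair_comm (X := Y) (Y := X)]
  simp only [FiberBundle.extend_apply_self, map_neg, neg_apply]
  ring

/-- The Levi-Civita connection is compatible with the metric. -/
theorem mvfderiv_pair_leviCivita (g : SmoothMetric I M) {X Y Z : Π x : M, TangentSpace I x} {x : M}
    (hX : MDiffAt (T% X) x) (hY : MDiffAt (T% Y) x) (hZ : MDiffAt (T% Z) x) :
    mvfderiv I (g.pair Y Z) x (X x)
      = g.inner x (g.leviCivita Y x (X x)) (Z x) + g.inner x (Y x) (g.leviCivita Z x (X x)) := by
  rw [g.symm x (Y x), g.inner_leviCivita hX hY hZ, g.inner_leviCivita hX hZ hY, koszul, koszul,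
    VectorField.mlieBracket_swap_apply (V := Z) (W := Y), g.pair_comm (X := Z) (Y := Y)]
  simp only [map_neg, neg_apply]
  ring

end SmoothMetric
end LeviCivita
lemma contMDiffAt_clm_of_apply {E : Type*} [NormedAddCommGroup E] [NormedSpace ℝ E]
    {H : Type*} [TopologicalSpace H] {I : ModelWithCorners ℝ E H}
    {M : Type*} [TopologicalSpace M] [ChartedSpace H M]
    {F G : Type*} [NormedAddCommGroup F] [NormedSpace ℝ F] [FiniteDimensional ℝ F]
    [NormedAddCommGroup G] [NormedSpace ℝ G] {f : M → F →L[ℝ] G} {x : M}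
    (h : ∀ v, ContMDiffAt I 𝓘(ℝ, G) ∞ (fun y ↦ f y v) x) :
    ContMDiffAt I 𝓘(ℝ, F →L[ℝ] G) ∞ f x := by
  let d := Module.finrank ℝ F
  have hd : d = Module.finrank ℝ (Fin d → ℝ) := (Module.finrank_fin_fun ℝ).symm
  let e₁ := ContinuousLinearEquiv.ofFinrankEq hd
  let e₂ := (ContinuousLinearEquiv.arrowCongr e₁ (1 : G ≃L[ℝ] G)).trans
    (ContinuousLinearEquiv.piRing (Fin d))
  have h2 : ContMDiffAt I 𝓘(ℝ, Fin d → G) ∞ (fun y ↦ e₂ (f y)) x := by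
    rw [contMDiffAt_pi_space]
    intro i
    exact h _
  have h3 := e₂.symm.contDiff.contMDiff.contMDiffAt.comp x h2 (n := ∞)
  refine h3.congr_of_eventuallyEq (Filter.Eventually.of_forall fun y ↦ ?_)
  simp

lemma contMDiff_bilinForm {E : Type*} [NormedAddCommGroup E] [NormedSpace ℝ E]
    [FiniteDimensional ℝ E]
    {H : Type*} [TopologicalSpace H] {I : ModelWithCorners ℝ E H}
    {M : Type*} [TopologicalSpace M] [ChartedSpace H M] [IsManifold I ∞ M]
    {φ : Π x : M, TangentSpace I x →L[ℝ] TangentSpace I x →L[ℝ] ℝ}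
    (h : ∀ (V W : Π x : M, TangentSpace I x) (x : M),
      ContMDiffAt I (I.prod 𝓘(ℝ, E)) ∞ (fun y ↦ TotalSpace.mk' E y (V y)) x →
      ContMDiffAt I (I.prod 𝓘(ℝ, E)) ∞ (fun y ↦ TotalSpace.mk' E y (W y)) x →
      ContMDiffAt I 𝓘(ℝ, ℝ) ∞ (fun y ↦ φ y (V y) (W y)) x) :
    ContMDiff I (I.prod 𝓘(ℝ, E →L[ℝ] E →L[ℝ] ℝ)) ∞
      (fun x ↦ TotalSpace.mk' (E →L[ℝ] E →L[ℝ] ℝ)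
        (E := fun x : M ↦ TangentSpace I x →L[ℝ] TangentSpace I x →L[ℝ] ℝ) x (φ x)) := by
  intro x
  rw [contMDiffAt_hom_bundle]
  refine ⟨contMDiffAt_id, ?_⟩
  refine contMDiffAt_clm_of_apply fun v ↦ contMDiffAt_clm_of_apply fun w ↦ ?_
  let e := trivializationAt E (fun y : M ↦ TangentSpace I y) x
  have hx := FiberBundle.mem_baseSet_trivializationAt' (F := E) (E := fun y : M ↦ TangentSpace I y) x
  have hs (v : E) : ContMDiffAt I (I.prod 𝓘(ℝ, E)) ∞
      (fun y ↦ TotalSpace.mk' E y (e.symm y v : TangentSpace I y)) x := by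
    rw [contMDiffAt_section]
    refine (contMDiffAt_const (c := v)).congr_of_eventuallyEq ?_
    filter_upwards [e.open_baseSet.mem_nhds hx] with y hy
    exact e.apply_mk_symm hy v ▸ rfl
  refine (h _ _ x (hs v) (hs w)).congr_of_eventuallyEq ?_
  filter_upwards [e.open_baseSet.mem_nhds hx] with y hy
  rw [inCoordinates_apply_eq₂ hy hy (by simp)]
  simp [e]

section Rolling

variable {E : Type*} [NormedAddCommGroup E] [NormedSpace ℝ E]
  {H : Type*} [TopologicalSpace H] {I : ModelWithCorners ℝ E H}
  {M : Type*} [TopologicalSpace M] [ChartedSpace H M] [IsManifold I ∞ M]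

/-- The vector bundle `TM ⊕ ℝ` over `M`, with model fibre `E × ℝ`. -/
abbrev TangentPlusLine (I : ModelWithCorners ℝ E H) (M : Type*) [TopologicalSpace M]
    [ChartedSpace H M] (x : M) : Type _ :=
  TangentSpace I x × Bundle.Trivial M ℝ x

lemma mdifferentiableAt_fst_section {σ : Π x : M, TangentPlusLine I M x} {x : M}
    (hσ : MDifferentiableAt I (I.prod 𝓘(ℝ, E × ℝ)) (fun y ↦ TotalSpace.mk' (E × ℝ) y (σ y)) x) :
    MDifferentiableAt I (I.prod 𝓘(ℝ, E)) (fun y ↦ TotalSpace.mk' E y (σ y).1) x := by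
  rw [mdifferentiableAt_totalSpace] at hσ ⊢
  refine ⟨hσ.1, ?_⟩
  exact ((ContinuousLinearMap.fst ℝ E ℝ).mdifferentiableAt).comp x hσ.2

lemma mdifferentiableAt_snd_section {σ : Π x : M, TangentPlusLine I M x} {x : M}
    (hσ : MDifferentiableAt I (I.prod 𝓘(ℝ, E × ℝ)) (fun y ↦ TotalSpace.mk' (E × ℝ) y (σ y)) x) :
    MDifferentiableAt I 𝓘(ℝ, ℝ) (fun y ↦ ((σ y).2 : ℝ)) x := by
  rw [mdifferentiableAt_totalSpace] at hσ
  have h := ((ContinuousLinearMap.snd ℝ E ℝ).mdifferentiableAt).comp (g := ContinuousLinearMap.snd ℝ E ℝ) x hσ.2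
  exact h

variable [FiniteDimensional ℝ E]

/-- The rolling connection of curvature `c` on `TM ⊕ ℝ`:
`∇_u (X, r) = (∇_u X + r u, u(r) - c g(X, u))`. -/
def rollingConnection (c : ℝ) (g : SmoothMetric I M) :
    CovariantDerivative I (E × ℝ) (TangentPlusLine I M) where
  toFun σ x :=
    (g.leviCivita (fun y ↦ (σ y).1) x
        + ((σ x).2 : ℝ) • ContinuousLinearMap.id ℝ (TangentSpace I x)).prod
      (mvfderiv I (fun y ↦ ((σ y).2 : ℝ)) x - c • g.inner x (σ x).1)
  isCovariantDerivativeOnUniv :=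
    { add := by
        intro σ σ' x hσ hσ' _
        have h1 := g.leviCivita.isCovariantDerivativeOnUniv.add
          (mdifferentiableAt_fst_section hσ) (mdifferentiableAt_fst_section hσ')
        have h2 := mvfderiv_fun_add (mdifferentiableAt_snd_section hσ)
          (mdifferentiableAt_snd_section hσ')
        refine ContinuousLinearMap.ext fun u ↦ Prod.ext ?_ ?_
        · have h3 := congr($h1 u)
          change g.leviCivita (fun y ↦ (σ y).1 + (σ' y).1) x u
            + ((σ x).2 + (σ' x).2 : ℝ) • u = (g.leviCivita (fun y ↦ (σ y).1) x u
            + ((σ x).2 : ℝ) • u) + (g.leviCivita (fun y ↦ (σ' y).1) x u + ((σ' x).2 : ℝ) • u)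
          refine (congrArg (· + ((σ x).2 + (σ' x).2 : ℝ) • u) h3).trans ?_
          simp only [add_apply]
          module
        · have h3 := congr($h2 u)
          change mvfderiv I (fun y ↦ ((σ y).2 + (σ' y).2 : ℝ)) x u
            - c * g.inner x ((σ x).1 + (σ' x).1) u
            = (mvfderiv I (fun y ↦ ((σ y).2 : ℝ)) x u - c * g.inner x (σ x).1 u)
            + (mvfderiv I (fun y ↦ ((σ' y).2 : ℝ)) x u - c * g.inner x (σ' x).1 u)
          rw [h3]
          simp only [add_apply, map_add]
          ring
      leibniz := by
        intro σ f x hσ hf _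
        have h1 := g.leviCivita.isCovariantDerivativeOnUniv.leibniz
          (mdifferentiableAt_fst_section hσ) hf
        have h2 := mvfderiv_fun_mul hf (mdifferentiableAt_snd_section hσ)
        refine ContinuousLinearMap.ext fun u ↦ Prod.ext ?_ ?_
        · have h3 := congr($h1 u)
          change g.leviCivita (fun y ↦ f y • (σ y).1) x u + (f x * (σ x).2 : ℝ) • u
            = f x • (g.leviCivita (fun y ↦ (σ y).1) x u + ((σ x).2 : ℝ) • u)
              + mvfderiv I f x u • (σ x).1
          refine (congrArg (· + (f x * (σ x).2 : ℝ) • u) h3).trans ?_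
          simp only [add_apply, smul_apply, ContinuousLinearMap.smulRight_apply]
          module
        · have h3 := congr($h2 u)
          change mvfderiv I (fun y ↦ (f y * (σ y).2 : ℝ)) x u - c * g.inner x (f x • (σ x).1) u
            = f x * (mvfderiv I (fun y ↦ ((σ y).2 : ℝ)) x u - c * g.inner x (σ x).1 u)
              + mvfderiv I f x u * (σ x).2
          rw [h3]
          simp only [add_apply, smul_apply, map_smul, smul_eq_mul]
          ring }
end Rolling

section Cone

variable {E : Type*} [NormedAddCommGroup E] [NormedSpace ℝ E]
  {H : Type*} [TopologicalSpace H] {I : ModelWithCorners ℝ E H}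
  {M : Type*} [TopologicalSpace M] [ChartedSpace H M]

/-- The manifold `ℝ₊ = (0, ∞)`, as an open subset of `ℝ`. -/
abbrev PosReal : TopologicalSpace.Opens ℝ := ⟨Ioi 0, isOpen_Ioi⟩

/-- The manifold `C(M) = M × ℝ₊` underlying the cone of `M`. -/
abbrev Cone (M : Type*) : Type _ := M × PosReal

namespace Cone

/-- The radial coordinate `s` of a point `(x, s)` of the cone. -/
def radius (p : Cone M) : ℝ := p.2

lemma radius_pos {M : Type*} (p : Cone M) : 0 < p.radius := p.2.2

lemma contMDiff_radius : ContMDiff (I.prod 𝓘(ℝ, ℝ)) 𝓘(ℝ, ℝ) ∞ (radius : Cone M → ℝ) :=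
  contMDiff_subtype_val.comp contMDiff_snd

variable (I) in
/-- The differential `X + b ∂_s ↦ X` of the projection `C(M) → M`. -/
def dproj (p : Cone M) : TangentSpace (I.prod 𝓘(ℝ, ℝ)) p →L[ℝ] TangentSpace I p.1 :=
  mfderiv (I.prod 𝓘(ℝ, ℝ)) I (Prod.fst : Cone M → M) p

variable (I) in
/-- The differential `X + b ∂_s ↦ b` of the radial coordinate. -/
def dradius (p : Cone M) : TangentSpace (I.prod 𝓘(ℝ, ℝ)) p →L[ℝ] ℝ :=
  mvfderiv (I.prod 𝓘(ℝ, ℝ)) (radius : Cone M → ℝ) p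

lemma dproj_apply (p : Cone M) (v : E × ℝ) : dproj I p v = v.1 := by
  rw [dproj, mfderiv_fst]
  rfl

lemma mfderiv_posReal (s : PosReal) :
    mfderiv 𝓘(ℝ, ℝ) 𝓘(ℝ, ℝ) (Subtype.val : PosReal → ℝ) s = ContinuousLinearMap.id ℝ ℝ := by
  have hc (x : PosReal) : ((chartAt ℝ s).symm (x : ℝ) : PosReal) = x := by
    have : chartAt ℝ s x = (x : ℝ) := rfl
    rw [← this]
    exact (chartAt ℝ s).left_inv (by rw [TopologicalSpace.Opens.chartAt_eq,
      OpenPartialHomeomorph.subtypeRestr_source]; exact mem_univ _)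
  have h : HasMFDerivAt 𝓘(ℝ, ℝ) 𝓘(ℝ, ℝ) (Subtype.val : PosReal → ℝ) s
      (ContinuousLinearMap.id ℝ ℝ) := by
    refine ⟨continuous_subtype_val.continuousAt, ?_⟩
    have hs : extChartAt 𝓘(ℝ, ℝ) s s = (s : ℝ) := rfl
    rw [hs]
    have h2 : HasFDerivWithinAt (fun x : ℝ ↦ x) (ContinuousLinearMap.id ℝ ℝ)
      (range 𝓘(ℝ, ℝ)) (s : ℝ) := hasFDerivWithinAt_id _ _
    refine h2.congr_of_eventuallyEq ?_ ?_
    · refine Filter.Eventually.filter_mono nhdsWithin_le_nhds ?_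
      filter_upwards [isOpen_Ioi.mem_nhds s.2] with x hx
      have := hc ⟨x, hx⟩
      exact congrArg Subtype.val this
    · exact congrArg Subtype.val (hc s)
  exact h.mfderiv

lemma dradius_apply (p : Cone M) (v : E × ℝ) : dradius I p v = v.2 := by
  have h : mfderiv (I.prod 𝓘(ℝ, ℝ)) 𝓘(ℝ, ℝ) (radius : Cone M → ℝ) p
      = (mfderiv 𝓘(ℝ, ℝ) 𝓘(ℝ, ℝ) (Subtype.val : PosReal → ℝ) p.2).comp
        (mfderiv (I.prod 𝓘(ℝ, ℝ)) 𝓘(ℝ, ℝ) (Prod.snd : Cone M → PosReal) p) :=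
    mfderiv_comp p ((contMDiff_subtype_val (n := 1)).mdifferentiable (by simp) p.2)
      mdifferentiableAt_snd
  change mfderiv (I.prod 𝓘(ℝ, ℝ)) 𝓘(ℝ, ℝ) (radius : Cone M → ℝ) p v = v.2
  rw [h, mfderiv_snd, mfderiv_posReal]
  rfl

/-- The linear isomorphism `T_{(x,s)} C(M) → T_x M × ℝ`, `X + b ∂_s ↦ (s X, b)`. -/
def tangentIso (I : ModelWithCorners ℝ E H) (p : Cone M) :
    TangentSpace (I.prod 𝓘(ℝ, ℝ)) p ≃ₗ[ℝ] TangentPlusLine I M p.1 :=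
  LinearEquiv.ofBijective
    ((p.radius • dproj I p).prod (dradius I p) :
      TangentSpace (I.prod 𝓘(ℝ, ℝ)) p →L[ℝ] TangentSpace I p.1 × ℝ).toLinearMap (by
    have h (v : E × ℝ) : ((p.radius • dproj I p).prod (dradius I p) :
        TangentSpace (I.prod 𝓘(ℝ, ℝ)) p →L[ℝ] TangentSpace I p.1 × ℝ) v
        = (p.radius • v.1, v.2) :=
      Prod.ext (congrArg (fun X : E ↦ p.radius • X) (dproj_apply p v)) (dradius_apply p v)
    have hs := p.radius_pos.ne'
    constructor
    · intro v w hvw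
      have h1 : (p.radius • v.1, v.2) = ((p.radius • w.1, w.2) : E × ℝ) :=
        (h v).symm.trans (Eq.trans hvw (h w))
      exact Prod.ext (α := E) (β := ℝ) (smul_right_injective E hs (congrArg Prod.fst h1))
        (congrArg Prod.snd h1 :)
    · intro w
      refine ⟨((p.radius⁻¹ • w.1 : E), (w.2 : ℝ)), (h _).trans ?_⟩
      exact Prod.ext (smul_inv_smul₀ hs (w.1 : E)) rfl)

lemma tangentIso_apply (p : Cone M) (v : TangentSpace (I.prod 𝓘(ℝ, ℝ)) p) :
    tangentIso I p v = (p.radius • dproj I p v, dradius I p v) := rfl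

variable [IsManifold I ∞ M]

/-- The bilinear form `s² g + ds²` on the tangent space of the cone at `(x, s)`. -/
def metricForm (g : SmoothMetric I M) (p : Cone M) :
    TangentSpace (I.prod 𝓘(ℝ, ℝ)) p →L[ℝ] TangentSpace (I.prod 𝓘(ℝ, ℝ)) p →L[ℝ] ℝ :=
  p.radius ^ 2 • ((ContinuousLinearMap.precomp ℝ (dproj I p)).comp
      ((g.inner p.1).comp (dproj I p)))
    + (dradius I p).smulRight (dradius I p)

lemma metricForm_apply (g : SmoothMetric I M) (p : Cone M)
    (v w : TangentSpace (I.prod 𝓘(ℝ, ℝ)) p) :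
    metricForm g p v w
      = p.radius ^ 2 * g.inner p.1 (dproj I p v) (dproj I p w) + dradius I p v * dradius I p w :=
  rfl

variable [FiniteDimensional ℝ E]

lemma contMDiff_metricForm (g : SmoothMetric I M) :
    ContMDiff (I.prod 𝓘(ℝ, ℝ)) ((I.prod 𝓘(ℝ, ℝ)).prod 𝓘(ℝ, E × ℝ →L[ℝ] E × ℝ →L[ℝ] ℝ)) ∞
      (fun p : Cone M ↦ TotalSpace.mk' (E × ℝ →L[ℝ] E × ℝ →L[ℝ] ℝ)
        (E := fun p : Cone M ↦ TangentSpace (I.prod 𝓘(ℝ, ℝ)) p →L[ℝ]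
          TangentSpace (I.prod 𝓘(ℝ, ℝ)) p →L[ℝ] ℝ) p (metricForm g p)) := by
  refine contMDiff_bilinForm fun V W p hV hW ↦ ?_
  have hpr {V : Π p : Cone M, TangentSpace (I.prod 𝓘(ℝ, ℝ)) p}
      (hV : ContMDiffAt (I.prod 𝓘(ℝ, ℝ)) ((I.prod 𝓘(ℝ, ℝ)).prod 𝓘(ℝ, E × ℝ)) ∞
        (fun y ↦ TotalSpace.mk' (E × ℝ) y (V y)) p) :
      ContMDiffAt (I.prod 𝓘(ℝ, ℝ)) (I.prod 𝓘(ℝ, E)) ∞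
        (fun q ↦ TotalSpace.mk' E q.1 (dproj I q (V q))) p :=
    ((contMDiff_fst (I := I) (J := 𝓘(ℝ, ℝ)) (M := M) (N := PosReal)
      (n := ∞)).contMDiff_tangentMap (m := ∞) (by simp)).contMDiffAt.comp p hV
  have hr {V : Π p : Cone M, TangentSpace (I.prod 𝓘(ℝ, ℝ)) p}
      (hV : ContMDiffAt (I.prod 𝓘(ℝ, ℝ)) ((I.prod 𝓘(ℝ, ℝ)).prod 𝓘(ℝ, E × ℝ)) ∞
        (fun y ↦ TotalSpace.mk' (E × ℝ) y (V y)) p) :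
      ContMDiffAt (I.prod 𝓘(ℝ, ℝ)) 𝓘(ℝ, ℝ) ∞ (fun q ↦ dradius I q (V q)) p := by
    have := ((contMDiff_radius (I := I) (M := M)).contMDiff_tangentMap (m := ∞)
      (by simp)).contMDiffAt.comp p hV
    rw [contMDiffAt_totalSpace] at this
    refine this.2.congr_of_eventuallyEq (Filter.Eventually.of_forall fun q ↦ ?_)
    simp [dradius, mvfderiv, tangentMap]
    rfl
  simp only [metricForm_apply]
  have hg := ContMDiffAt.clm_bundle_apply₂ (E₃ := Bundle.Trivial M ℝ) (F₃ := ℝ)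
    (b := fun q : Cone M ↦ q.1) ((g.contMDiff p.1).comp p contMDiffAt_fst) (hpr hV) (hpr hW)
  rw [contMDiffAt_totalSpace] at hg
  exact (((contMDiff_radius p).pow 2).mul hg.2).add ((hr hV).mul (hr hW))

/-- The Riemannian metric `s² g + ds²` of the cone `C(M) = M × ℝ₊`. -/
def metric (g : SmoothMetric I M) : SmoothMetric (I.prod 𝓘(ℝ, ℝ)) (Cone M) where
  inner p := metricForm g p
  symm p v w := by
    rw [metricForm_apply, metricForm_apply, g.symm]
    ring
  pos p v hv := by
    rw [metricForm_apply]
    have hr := pow_pos p.radius_pos 2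
    by_cases h1 : dproj I p v = 0
    · have h2 : dradius I p v ≠ 0 := by
        intro h2
        exact hv (Prod.ext ((dproj_apply p v).symm.trans h1) ((dradius_apply p v).symm.trans h2))
      have := mul_self_pos.2 h2
      simpa [h1] using this
    · have := mul_pos hr (g.pos p.1 _ h1)
      nlinarith [mul_self_nonneg (dradius I p v)]
  isVonNBounded p := by
    have hr := p.radius_pos
    have h1 : Bornology.IsBounded ((p.radius⁻¹ • ContinuousLinearMap.id ℝ E) ''
        {v : E | g.inner p.1 v v < 1}) :=
      (NormedSpace.isVonNBounded_iff ℝ).1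
        (Bornology.IsVonNBounded.image (E := E) (g.isVonNBounded p.1) _)
    have h2 : Bornology.IsBounded (Metric.ball (0 : ℝ) 1) := Metric.isBounded_ball
    refine Bornology.IsVonNBounded.subset (𝕜 := ℝ) (E := E × ℝ) ?_
      ((NormedSpace.isVonNBounded_iff ℝ).2 (h1.prod h2))
    rintro ⟨X, b⟩ hv
    have hv' : p.radius ^ 2 * g.inner p.1 X X + b * b < 1 := by
      have := hv
      change metricForm g p (X, b) (X, b) < 1 at this
      have e : metricForm g p (X, b) (X, b) = p.radius ^ 2 * g.inner p.1 (dproj I p (X, b))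
        (dproj I p (X, b)) + dradius I p (X, b) * dradius I p (X, b) := rfl
      rw [e, dproj_apply, dradius_apply] at this
      exact this
    have hX : 0 ≤ g.inner p.1 X X := g.inner_self_nonneg X
    refine ⟨⟨p.radius • X, ?_, ?_⟩, ?_⟩
    · have := g.inner_smul_smul (x := p.1) p.radius X
      exact this.trans_lt (by nlinarith [mul_self_nonneg b])
    · simp [smul_smul, hr.ne']
    · rw [Metric.mem_ball, dist_zero_right, Real.norm_eq_abs, abs_lt]
      have : 0 ≤ p.radius ^ 2 * g.inner p.1 X X := mul_nonneg (sq_nonneg _) hX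
      constructor <;> nlinarith
  contMDiff := contMDiff_metricForm g

end Cone
end Cone

section Holonomy

variable {E : Type*} [NormedAddCommGroup E] [NormedSpace ℝ E]
  {H : Type*} [TopologicalSpace H] {I : ModelWithCorners ℝ E H}
  {M : Type*} [TopologicalSpace M] [ChartedSpace H M]

/-- `γ` restricts to a continuous piecewise `C^k` curve on `[0, 1]`: there is a finite set `S` of
exceptional times such that `γ` is `C^k` on each closed interval `[a, b] ⊆ [0, 1]` whose interior
does not meet `S`. -/
def IsPiecewiseContMDiff (I : ModelWithCorners ℝ E H) (k : ℕ∞) (γ : ℝ → M) : Prop :=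
  ∃ S : Set ℝ, S.Finite ∧ ∀ a b : ℝ, 0 ≤ a → a < b → b ≤ 1 → Disjoint (Ioo a b) S →
    ContMDiffOn 𝓘(ℝ, ℝ) I k γ (Icc a b)

/-- `γ` restricts to a piecewise `C^k` loop based at `x`, parametrized by `[0, 1]`. -/
structure IsPiecewiseLoop (I : ModelWithCorners ℝ E H) (k : ℕ∞) (γ : ℝ → M) (x : M) : Prop where
  piecewise : IsPiecewiseContMDiff I k γ
  source : γ 0 = x
  target : γ 1 = x

/-- The velocity `γ'(t)` of a curve. -/
def velocity (I : ModelWithCorners ℝ E H) (γ : ℝ → M) (t : ℝ) : TangentSpace I (γ t) :=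
  mfderiv 𝓘(ℝ, ℝ) I γ t (1 : ℝ)

lemma velocity_congr {γ γ' : ℝ → M} {t : ℝ} (h : γ =ᶠ[𝓝 t] γ') :
    (velocity I γ t : E) = velocity I γ' t :=
  congrArg (fun L : ℝ →L[ℝ] E ↦ L 1) h.mfderiv_eq

lemma velocity_const (x : M) (t : ℝ) : velocity I (fun _ ↦ x) t = 0 :=
  congrArg (fun L : ℝ →L[ℝ] E ↦ L 1) mfderiv_const

lemma velocity_comp_affine {γ : ℝ → M} {a b t : ℝ}
    (hγ : MDifferentiableAt 𝓘(ℝ, ℝ) I γ (a * t + b)) :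
    velocity I (fun u ↦ γ (a * u + b)) t = a • velocity I γ (a * t + b) := by
  have hd : HasDerivAt (fun u : ℝ ↦ a * u + b) a t := by
    simpa using ((hasDerivAt_id t).const_mul a).add_const b
  have hm : HasMFDerivAt 𝓘(ℝ, ℝ) 𝓘(ℝ, ℝ) (fun u : ℝ ↦ a * u + b) t
    (ContinuousLinearMap.toSpanSingleton ℝ a) := hd.hasFDerivAt.hasMFDerivAt
  have h := (hγ.hasMFDerivAt.comp t hm).mfderiv
  have aux (L : ℝ →L[ℝ] E) : (L.comp (ContinuousLinearMap.toSpanSingleton ℝ a)) 1 = a • L 1 := by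
    simp [← map_smul]
  exact (congrArg (fun L : ℝ →L[ℝ] E ↦ L 1) h).trans (aux _)

variable {F : Type*} [NormedAddCommGroup F] [NormedSpace ℝ F]
  {V : M → Type*} [TopologicalSpace (TotalSpace F V)]
  [∀ x, AddCommGroup (V x)] [∀ x, Module ℝ (V x)]
  [∀ x : M, TopologicalSpace (V x)]
  [∀ x, IsTopologicalAddGroup (V x)] [∀ x, ContinuousSMul ℝ (V x)]
  [FiberBundle F V]

/-- The covariant derivative at `p = (x, v)` of a vector field along a curve that has value `v` and
covers a curve with velocity `u`, where `d` is the velocity of the fibre component in the preferred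
local trivialization at `x`. Writing the field as `∑ vⁱ(t) eᵢ(γ(t))` in the frame `e` of the
trivialization, this is the usual expression `∑ (vⁱ)' eᵢ + ∑ vⁱ ∇_u eᵢ`: the local section
`∑ vⁱ eᵢ` with constant coefficients is `FiberBundle.extend F v`. -/
def covDerivAt (cov : CovariantDerivative I F V) (p : TotalSpace F V) (d : F)
    (u : TangentSpace I p.proj) : V p.proj :=
  (trivializationAt F V p.proj).symm p.proj d + cov (FiberBundle.extend F p.2) p.proj u

/-- The covariant derivative `∇_{γ'(t)} v(t)` of a vector field `v` along a curve `γ`: such a field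
is encoded as the curve `c = (γ, v)` in the total space of the bundle. -/
def covDerivAlong (cov : CovariantDerivative I F V) (c : ℝ → TotalSpace F V) (t : ℝ) :
    V (c t).proj :=
  covDerivAt cov (c t) (deriv (fun u ↦ (trivializationAt F V (c t).proj (c u)).2) t)
    (velocity I (fun u ↦ (c u).proj) t)

/-- The vector field along a curve given by `c` is differentiable at `t`, with vanishing covariant
derivative. -/
def IsParallelAt (cov : CovariantDerivative I F V) (c : ℝ → TotalSpace F V) (t : ℝ) : Prop :=
  MDifferentiableAt 𝓘(ℝ, ℝ) (I.prod 𝓘(ℝ, F)) c t ∧ covDerivAlong cov c t = 0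

/-- The vector field along a curve given by `c` is parallel on `[0, 1]`: it is continuous and, with
finitely many exceptions, differentiable with vanishing covariant derivative. -/
def IsParallel (cov : CovariantDerivative I F V) (c : ℝ → TotalSpace F V) : Prop :=
  ContinuousOn c (Icc 0 1) ∧ ∃ S : Set ℝ, S.Finite ∧ ∀ t ∈ Ioo (0 : ℝ) 1 \ S, IsParallelAt cov c t

/-- There is a parallel vector field along `γ` on `[0, 1]` with value `v` at time `0` and value
`w` at time `1`. -/
def Transports (cov : CovariantDerivative I F V) (γ : ℝ → M) {x y : M} (v : V x) (w : V y) :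
    Prop :=
  ∃ c : ℝ → TotalSpace F V, IsParallel cov c ∧ (∀ t ∈ Icc (0 : ℝ) 1, (c t).proj = γ t) ∧
    c 0 = TotalSpace.mk' F x v ∧ c 1 = TotalSpace.mk' F y w

/-- `P` is the parallel transport along `γ` from `γ 0 = x` to `γ 1 = y`: for every `v` there are
parallel fields along `γ` starting at `v`, and all of them end at `P v`. -/
def IsParallelTransport (cov : CovariantDerivative I F V) (γ : ℝ → M) {x y : M}
    (P : V x → V y) : Prop :=
  ∀ v w, Transports cov γ v w ↔ w = P v

lemma covDerivAlong_congr (cov : CovariantDerivative I F V) {c c' : ℝ → TotalSpace F V} {t : ℝ}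
    (h : c =ᶠ[𝓝 t] c') (h0 : covDerivAlong cov c t = 0) : covDerivAlong cov c' t = 0 := by
  have key : ∀ p : TotalSpace F V, p = c t → p = c' t →
      covDerivAlong cov c t = 0 → covDerivAlong cov c' t = 0 := by
    intro p hp hp'
    have e : covDerivAlong cov c t = 0 ↔ covDerivAt cov p
        (deriv (fun u ↦ (trivializationAt F V p.proj (c u)).2) t)
        (velocity I (fun u ↦ (c u).proj) t : E) = 0 := by
      subst hp; rfl
    have e' : covDerivAlong cov c' t = 0 ↔ covDerivAt cov p
        (deriv (fun u ↦ (trivializationAt F V p.proj (c' u)).2) t)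
        (velocity I (fun u ↦ (c' u).proj) t : E) = 0 := by
      subst hp'; rfl
    have h1 : deriv (fun u ↦ (trivializationAt F V p.proj (c u)).2) t
        = deriv (fun u ↦ (trivializationAt F V p.proj (c' u)).2) t :=
      Filter.EventuallyEq.deriv_eq (h.mono fun u hu ↦ by simp only [hu])
    have h2 : (velocity I (fun u ↦ (c u).proj) t : E) = velocity I (fun u ↦ (c' u).proj) t :=
      velocity_congr (h.mono fun u hu ↦ by simp only [hu])
    rw [e, e', h1]
    intro h3
    exact (congrArg (fun u : E ↦ covDerivAt cov p _ (u : TangentSpace I p.proj)) h2).symm.trans h3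
  exact key _ rfl h.eq_of_nhds h0

lemma IsParallelAt.congr {cov : CovariantDerivative I F V} {c c' : ℝ → TotalSpace F V} {t : ℝ}
    (h0 : IsParallelAt cov c t) (h : c =ᶠ[𝓝 t] c') : IsParallelAt cov c' t :=
  ⟨h0.1.congr_of_eventuallyEq h.symm, covDerivAlong_congr cov h h0.2⟩

variable [VectorBundle ℝ F V]

lemma IsParallelAt.comp_affine {cov : CovariantDerivative I F V} {c : ℝ → TotalSpace F V}
    {a b t : ℝ} (h0 : IsParallelAt cov c (a * t + b)) :
    IsParallelAt cov (fun u ↦ c (a * u + b)) t := by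
  have hd : HasDerivAt (fun u : ℝ ↦ a * u + b) a t := by
    simpa using ((hasDerivAt_id t).const_mul a).add_const b
  have hm : HasMFDerivAt 𝓘(ℝ, ℝ) 𝓘(ℝ, ℝ) (fun u : ℝ ↦ a * u + b) t
    (ContinuousLinearMap.toSpanSingleton ℝ a) := hd.hasFDerivAt.hasMFDerivAt
  refine ⟨h0.1.comp t hm.mdifferentiableAt, ?_⟩
  have h1 := (mdifferentiableAt_totalSpace _ c).1 h0.1
  have e1 : deriv (fun u ↦ (trivializationAt F V (c (a * t + b)).proj (c (a * u + b))).2) t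
      = a • deriv (fun u ↦ (trivializationAt F V (c (a * t + b)).proj (c u)).2) (a * t + b) :=
    (HasDerivAt.scomp
      (g₁ := fun u ↦ (trivializationAt F V (c (a * t + b)).proj (c u)).2) t
      h1.2.differentiableAt.hasDerivAt hd).deriv
  have e2 : velocity I (fun u ↦ (c (a * u + b)).proj) t
      = a • velocity I (fun u ↦ (c u).proj) (a * t + b) :=
    velocity_comp_affine (γ := fun u ↦ (c u).proj) h1.1
  have h2 := h0.2
  rw [covDerivAlong, covDerivAt] at h2 ⊢
  have e3 (d : F) : (trivializationAt F V (c (a * t + b)).proj).symm (c (a * t + b)).proj (a • d)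
      = a • (trivializationAt F V (c (a * t + b)).proj).symm (c (a * t + b)).proj d := by
    have hb := FiberBundle.mem_baseSet_trivializationAt' (F := F) (E := V) (c (a * t + b)).proj
    simpa only [Trivialization.symmₗ_apply _ hb] using
      ((trivializationAt F V (c (a * t + b)).proj).symmₗ ℝ (c (a * t + b)).proj).map_smul a d
  rw [e1, e2, e3, map_smul, ← smul_add, h2, smul_zero]

lemma isParallelAt_const (cov : CovariantDerivative I F V) (p : TotalSpace F V) (t : ℝ) :
    IsParallelAt cov (fun _ ↦ p) t := by
  refine ⟨mdifferentiableAt_const, ?_⟩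
  rw [covDerivAlong, covDerivAt, velocity_const, deriv_const, map_zero, add_zero]
  have hb := FiberBundle.mem_baseSet_trivializationAt' (F := F) (E := V) p.proj
  simpa only [Trivialization.symmₗ_apply _ hb] using
    ((trivializationAt F V p.proj).symmₗ ℝ p.proj).map_zero

lemma isParallel_const (cov : CovariantDerivative I F V) (p : TotalSpace F V) :
    IsParallel cov (fun _ ↦ p) :=
  ⟨continuousOn_const, ∅, finite_empty, fun t _ ↦ isParallelAt_const cov p t⟩

lemma IsParallel.comp_affine {cov : CovariantDerivative I F V} {c : ℝ → TotalSpace F V}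
    (h : IsParallel cov c) {a b : ℝ} (ha : a ≠ 0)
    (hab : MapsTo (fun u ↦ a * u + b) (Icc 0 1) (Icc 0 1))
    (hab' : MapsTo (fun u ↦ a * u + b) (Ioo 0 1) (Ioo 0 1)) :
    IsParallel cov (fun u ↦ c (a * u + b)) := by
  obtain ⟨hc, S, hS, hpar⟩ := h
  refine ⟨hc.comp (by fun_prop) hab, (fun u ↦ a * u + b) ⁻¹' S, hS.preimage ?_, ?_⟩
  · intro u _ v _ huv
    simpa [ha] using huv
  · intro t ht
    exact (hpar _ ⟨hab' ht.1, ht.2⟩).comp_affine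

/-- Concatenation of two curves parametrized by `[0, 1]`. -/
def concat {X : Type*} (c₁ c₂ : ℝ → X) : ℝ → X :=
  fun u ↦ if u ≤ 1 / 2 then c₁ (2 * u + 0) else c₂ (2 * u + -1)

lemma concat_eqOn_left {X : Type*} (c₁ c₂ : ℝ → X) :
    EqOn (concat c₁ c₂) (fun u ↦ c₁ (2 * u + 0)) (Iic (1 / 2)) :=
  fun _ hu ↦ if_pos hu

lemma concat_eqOn_right {X : Type*} {c₁ c₂ : ℝ → X} (h : c₁ 1 = c₂ 0) :
    EqOn (concat c₁ c₂) (fun u ↦ c₂ (2 * u + -1)) (Ici (1 / 2)) := by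
  intro u hu
  rcases eq_or_lt_of_le (mem_Ici.1 hu) with rfl | hu
  · simp [concat, h]
  · exact if_neg (not_le.2 hu)

lemma IsParallel.concat {cov : CovariantDerivative I F V} {c₁ c₂ : ℝ → TotalSpace F V}
    (h₁ : IsParallel cov c₁) (h₂ : IsParallel cov c₂) (h : c₁ 1 = c₂ 0) :
    IsParallel cov (concat c₁ c₂) := by
  obtain ⟨hc₁, S₁, hS₁, hp₁⟩ := h₁
  obtain ⟨hc₂, S₂, hS₂, hp₂⟩ := h₂
  have hinj (b : ℝ) : Function.Injective (fun u : ℝ ↦ 2 * u + b) := fun u v huv ↦ by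
    simpa using huv
  refine ⟨?_, (fun u ↦ 2 * u + 0) ⁻¹' S₁ ∪ (fun u ↦ 2 * u + -1) ⁻¹' S₂ ∪ {1 / 2},
    ((hS₁.preimage (hinj _).injOn).union (hS₂.preimage (hinj _).injOn)).union
      (finite_singleton _), ?_⟩
  · have e : Icc (0 : ℝ) 1 = Icc 0 (1 / 2) ∪ Icc (1 / 2) 1 :=
      (Icc_union_Icc_eq_Icc (by norm_num) (by norm_num)).symm
    rw [e]
    refine ContinuousOn.union_of_isClosed ?_ ?_ isClosed_Icc isClosed_Icc
    · refine ContinuousOn.congr ?_ ((concat_eqOn_left c₁ c₂).mono Icc_subset_Iic_self)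
      refine hc₁.comp (by fun_prop) fun u hu ↦ ?_
      constructor <;> linarith [hu.1, hu.2]
    · refine ContinuousOn.congr ?_ ((concat_eqOn_right h).mono Icc_subset_Ici_self)
      refine hc₂.comp (by fun_prop) fun u hu ↦ ?_
      constructor <;> linarith [hu.1, hu.2]
  · rintro t ⟨ht, htS⟩
    simp only [mem_union, mem_preimage, mem_singleton_iff, not_or] at htS
    rcases lt_or_gt_of_ne htS.2 with hlt | hlt
    · have := (hp₁ (2 * t + 0) ⟨⟨by linarith [ht.1], by linarith⟩, htS.1.1⟩).comp_affine
      refine this.congr ?_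
      filter_upwards [Iio_mem_nhds hlt] with u hu
      exact (concat_eqOn_left c₁ c₂ (mem_Iio.1 hu).le).symm
    · have := (hp₂ (2 * t + -1) ⟨⟨by linarith, by linarith [ht.2]⟩, htS.1.2⟩).comp_affine
      refine this.congr ?_
      filter_upwards [Ioi_mem_nhds hlt] with u hu
      exact (concat_eqOn_right h (mem_Ioi.1 hu).le).symm

lemma transports_const_iff (cov : CovariantDerivative I F V) [CompleteSpace F] {x : M}
    (v w : V x) : Transports cov (fun _ ↦ x) v w ↔ w = v := by
  constructor
  · rintro ⟨c, ⟨hc, S, hS, hp⟩, hpr, h0, h1⟩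
    set e := trivializationAt F V x with he
    have hx : x ∈ e.baseSet := FiberBundle.mem_baseSet_trivializationAt' x
    let f : ℝ → F := fun u ↦ (e (c u)).2
    have hf : ContinuousOn f (Icc 0 1) := by
      refine continuous_snd.comp_continuousOn (e.continuousOn.comp hc fun u hu ↦ ?_)
      rw [e.mem_source, hpr u hu]
      exact hx
    have hd : ∀ t ∈ Ioo (0 : ℝ) 1 \ S, HasDerivAt f 0 t := by
      intro t ht
      obtain ⟨hm, hz⟩ := hp t ht
      have hct : (c t).proj = x := hpr t (Ioo_subset_Icc_self ht.1)
      have hm' := ((mdifferentiableAt_totalSpace _ c).1 hm).2.differentiableAt.hasDerivAt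
      have hv : velocity I (fun u ↦ (c u).proj) t = 0 := by
        have : (fun u ↦ (c u).proj) =ᶠ[𝓝 t] fun _ ↦ x := by
          filter_upwards [isOpen_Ioo.mem_nhds ht.1] with u hu
          exact hpr u (Ioo_subset_Icc_self hu)
        exact (velocity_congr this).trans (velocity_const x t)
      rw [covDerivAlong, covDerivAt, hv, map_zero, add_zero] at hz
      have hb : (c t).proj ∈ (trivializationAt F V (c t).proj).baseSet :=
        FiberBundle.mem_baseSet_trivializationAt' _
      have hd0 : deriv (fun u ↦ (trivializationAt F V (c t).proj (c u)).2) t = 0 := by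
        have := congrArg (fun z ↦ (trivializationAt F V (c t).proj ⟨(c t).proj, z⟩).2) hz
        simp only [Trivialization.apply_mk_symm _ hb] at this
        rw [this]
        have h0 := ((trivializationAt F V (c t).proj).linearMapAt ℝ (c t).proj).map_zero
        rwa [Trivialization.coe_linearMapAt_of_mem _ hb] at h0
      rw [hd0, hct] at hm'
      exact hm'
    have hint := MeasureTheory.integral_eq_of_hasDerivAt_off_countable_of_le f (fun _ ↦ 0)
      zero_le_one hS.countable hf hd (by simp)
    simp only [intervalIntegral.integral_zero] at hint
    have h01 : f 1 = f 0 := (sub_eq_zero.1 hint.symm)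
    simp only [f, h0, h1] at h01
    have := (e.continuousLinearEquivAt ℝ x hx).injective (a₁ := w) (a₂ := v)
    exact this h01
  · rintro rfl
    exact ⟨fun _ ↦ TotalSpace.mk' F x w, isParallel_const cov _, fun _ _ ↦ rfl, rfl, rfl⟩

lemma Transports.reverse {cov : CovariantDerivative I F V} {γ : ℝ → M} {x y : M} {v : V x}
    {w : V y} (h : Transports cov γ v w) : Transports cov (fun u ↦ γ (-1 * u + 1)) w v := by
  obtain ⟨c, hc, hpr, h0, h1⟩ := h
  have hmaps : MapsTo (fun u : ℝ ↦ -1 * u + 1) (Icc 0 1) (Icc 0 1) := fun u hu ↦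
    ⟨by linarith [hu.2], by linarith [hu.1]⟩
  refine ⟨fun u ↦ c (-1 * u + 1), hc.comp_affine (by norm_num) hmaps fun u hu ↦
    ⟨by linarith [hu.2], by linarith [hu.1]⟩, fun t ht ↦ hpr _ (hmaps ht), ?_, ?_⟩
  · simpa using h1
  · simpa using h0

lemma transports_concat_iff {cov : CovariantDerivative I F V} {γ₁ γ₂ : ℝ → M} {x y z : M}
    (h₁ : γ₁ 1 = y) (h₂ : γ₂ 0 = y) {v : V x} {w : V z} :
    Transports cov (concat γ₁ γ₂) v w ↔
      ∃ u : V y, Transports cov γ₁ v u ∧ Transports cov γ₂ u w := by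
  have hγ : γ₁ 1 = γ₂ 0 := h₁.trans h₂.symm
  constructor
  · rintro ⟨c, hc, hpr, h0, h1⟩
    have hy : (c (1 / 2)).proj = y := by
      rw [hpr _ ⟨by norm_num, by norm_num⟩, ← h₁]
      simp [concat]
    obtain ⟨u, hu⟩ : ∃ u : V y, c (1 / 2) = TotalSpace.mk' F y u := by
      subst hy
      exact ⟨(c (1 / 2)).2, rfl⟩
    refine ⟨u, ⟨fun u ↦ c (1 / 2 * u + 0), hc.comp_affine (by norm_num) ?_ ?_, ?_, ?_, ?_⟩,
      ⟨fun u ↦ c (1 / 2 * u + 1 / 2), hc.comp_affine (by norm_num) ?_ ?_, ?_, ?_, ?_⟩⟩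
    · exact fun u hu ↦ ⟨by linarith [hu.1], by linarith [hu.2]⟩
    · exact fun u hu ↦ ⟨by linarith [hu.1], by linarith [hu.2]⟩
    · intro t ht
      rw [hpr _ ⟨by linarith [ht.1], by linarith [ht.2]⟩,
        concat_eqOn_left _ _ (mem_Iic.2 (by linarith [ht.2]))]
      dsimp only
      congr 1
      ring
    · simpa using h0
    · simpa using hu
    · exact fun u hu ↦ ⟨by linarith [hu.1], by linarith [hu.2]⟩
    · exact fun u hu ↦ ⟨by linarith [hu.1], by linarith [hu.2]⟩
    · intro t ht
      rw [hpr _ ⟨by linarith [ht.1], by linarith [ht.2]⟩,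
        concat_eqOn_right hγ (mem_Ici.2 (by linarith [ht.1]))]
      dsimp only
      congr 1
      ring
    · simpa using hu
    · dsimp only
      rw [← h1]
      norm_num
  · rintro ⟨u, ⟨c₁, hc₁, hpr₁, h01, h11⟩, ⟨c₂, hc₂, hpr₂, h02, h12⟩⟩
    have hcc : c₁ 1 = c₂ 0 := h11.trans h02.symm
    refine ⟨concat c₁ c₂, hc₁.concat hc₂ hcc, fun t ht ↦ ?_, ?_, ?_⟩
    · rcases le_total t (1 / 2) with h | h
      · rw [concat_eqOn_left _ _ h, concat_eqOn_left _ _ h]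
        exact hpr₁ _ ⟨by linarith [ht.1], by linarith⟩
      · rw [concat_eqOn_right hcc h, concat_eqOn_right hγ h]
        exact hpr₂ _ ⟨by linarith, by linarith [ht.2]⟩
    · rw [← h01]
      simp [concat]
    · rw [← h12, concat_eqOn_right hcc (by norm_num)]
      norm_num

lemma contMDiff_affine (a b : ℝ) : ContMDiff 𝓘(ℝ, ℝ) 𝓘(ℝ, ℝ) ∞ (fun u : ℝ ↦ a * u + b) :=
  ((contDiff_const.mul contDiff_id).add contDiff_const).contMDiff

lemma isPiecewiseLoop_const (I : ModelWithCorners ℝ E H) (k : ℕ∞) (x : M) :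
    IsPiecewiseLoop I k (fun _ ↦ x) x :=
  ⟨⟨∅, finite_empty, fun _ _ _ _ _ _ ↦ contMDiffOn_const⟩, rfl, rfl⟩

lemma IsPiecewiseLoop.reverse {k : ℕ∞} {γ : ℝ → M} {x : M} (h : IsPiecewiseLoop I k γ x) :
    IsPiecewiseLoop I k (fun u ↦ γ (-1 * u + 1)) x := by
  obtain ⟨⟨S, hS, hγ⟩, h0, h1⟩ := h
  refine ⟨⟨(fun u ↦ -1 * u + 1) ⁻¹' S, hS.preimage ?_, fun a b ha hab hb hd ↦ ?_⟩,
    by simpa using h1, by simpa using h0⟩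
  · intro u _ v _ huv
    simpa using huv
  · refine (hγ (-1 * b + 1) (-1 * a + 1) (by linarith) (by linarith) (by linarith) ?_).comp
      ((contMDiff_affine (-1) 1).of_le (by exact_mod_cast le_top)).contMDiffOn fun u hu ↦ ?_
    · rw [Set.disjoint_left] at hd ⊢
      intro t ht htS
      refine hd (a := -1 * t + 1) ⟨by linarith [ht.2], by linarith [ht.1]⟩ ?_
      rw [mem_preimage]
      convert htS using 1
      ring
    · exact ⟨by linarith [hu.2], by linarith [hu.1]⟩

lemma IsPiecewiseLoop.concat {k : ℕ∞} {γ₁ γ₂ : ℝ → M} {x : M} (h₁ : IsPiecewiseLoop I k γ₁ x)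
    (h₂ : IsPiecewiseLoop I k γ₂ x) : IsPiecewiseLoop I k (concat γ₁ γ₂) x := by
  obtain ⟨⟨S₁, hS₁, hγ₁⟩, h01, h11⟩ := h₁
  obtain ⟨⟨S₂, hS₂, hγ₂⟩, h02, h12⟩ := h₂
  have hinj (b : ℝ) : Function.Injective (fun u : ℝ ↦ 2 * u + b) := fun u v huv ↦ by
    simpa using huv
  have h : γ₁ 1 = γ₂ 0 := h11.trans h02.symm
  refine ⟨⟨(fun u ↦ 2 * u + 0) ⁻¹' S₁ ∪ (fun u ↦ 2 * u + -1) ⁻¹' S₂ ∪ {1 / 2},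
    ((hS₁.preimage (hinj _).injOn).union (hS₂.preimage (hinj _).injOn)).union
      (finite_singleton _), fun a b ha hab hb hd ↦ ?_⟩, ?_, ?_⟩
  · rw [Set.disjoint_left] at hd
    have hhalf : b ≤ 1 / 2 ∨ 1 / 2 ≤ a := by
      by_contra! hcon
      exact hd (a := 1 / 2) ⟨hcon.2, hcon.1⟩ (Or.inr rfl)
    rcases hhalf with hb' | ha'
    · refine ContMDiffOn.congr ?_
        ((concat_eqOn_left γ₁ γ₂).mono fun u hu ↦ mem_Iic.2 (hu.2.trans hb'))
      refine (hγ₁ (2 * a + 0) (2 * b + 0) (by linarith) (by linarith) (by linarith) ?_).comp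
        ((contMDiff_affine 2 0).of_le (by exact_mod_cast le_top)).contMDiffOn fun u hu ↦ ?_
      · rw [Set.disjoint_left]
        intro t ht htS
        refine hd (a := t / 2) ⟨by linarith [ht.1], by linarith [ht.2]⟩ (Or.inl (Or.inl ?_))
        rw [mem_preimage]
        convert htS using 1
        ring
      · exact ⟨by linarith [hu.1], by linarith [hu.2]⟩
    · refine ContMDiffOn.congr ?_
        ((concat_eqOn_right h).mono fun u hu ↦ mem_Ici.2 (ha'.trans hu.1))
      refine (hγ₂ (2 * a + -1) (2 * b + -1) (by linarith) (by linarith) (by linarith) ?_).comp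
        ((contMDiff_affine 2 (-1)).of_le (by exact_mod_cast le_top)).contMDiffOn fun u hu ↦ ?_
      · rw [Set.disjoint_left]
        intro t ht htS
        refine hd (a := (t + 1) / 2) ⟨by linarith [ht.1], by linarith [ht.2]⟩ (Or.inl (Or.inr ?_))
        rw [mem_preimage]
        convert htS using 1
        ring
      · exact ⟨by linarith [hu.1], by linarith [hu.2]⟩
  · rw [← h01]
    simp [_root_.concat]
  · rw [← h12, concat_eqOn_right h (by norm_num)]
    norm_num

/-- The holonomy group at `x` of a connection on a vector bundle: the group of all linear
automorphisms of the fibre over `x` that are the parallel transport along some piecewise `C^k` loop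
based at `x`. -/
def holonomyGroup [CompleteSpace F] (k : ℕ∞) (cov : CovariantDerivative I F V) (x : M) :
    Subgroup (V x ≃ₗ[ℝ] V x) where
  carrier := {A | ∃ γ : ℝ → M, IsPiecewiseLoop I k γ x ∧ IsParallelTransport cov γ A}
  one_mem' := ⟨fun _ ↦ x, isPiecewiseLoop_const I k x, fun v w ↦ transports_const_iff cov v w⟩
  mul_mem' := by
    rintro A B ⟨α, hα, hA⟩ ⟨β, hβ, hB⟩
    refine ⟨concat β α, hβ.concat hα, fun v w ↦ ?_⟩
    rw [transports_concat_iff hβ.target hα.source]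
    constructor
    · rintro ⟨u, hu, hw⟩
      rw [(hB v u).1 hu] at hw
      exact (hA _ w).1 hw
    · rintro rfl
      exact ⟨B v, (hB _ _).2 rfl, (hA _ _).2 rfl⟩
  inv_mem' := by
    rintro A ⟨γ, hγ, hA⟩
    refine ⟨_, hγ.reverse, fun v w ↦ ?_⟩
    have hr : (fun u ↦ (fun u ↦ γ (-1 * u + 1)) (-1 * u + 1)) = γ := by
      ext u
      simp
    have h : Transports cov (fun u ↦ γ (-1 * u + 1)) v w ↔ Transports cov γ w v :=
      ⟨fun h ↦ by simpa only [hr] using h.reverse, fun h ↦ h.reverse⟩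
    rw [h, hA w v]
    exact ⟨fun h ↦ h ▸ (A.symm_apply_apply w).symm, fun h ↦ h ▸ (A.apply_symm_apply v).symm⟩

end Holonomy

end

noncomputable section

section LinearODE

/-- Local solvability of linear ordinary differential equations with continuous coefficients. -/
lemma exists_hasDerivAt_of_continuous_clm {G : Type*} [NormedAddCommGroup G] [NormedSpace ℝ G]
    [CompleteSpace G] {B : ℝ → G →L[ℝ] G} (hB : Continuous B) (t₀ : ℝ) (x₀ : G) :
    ∃ ε > 0, ∃ α : ℝ → G, α t₀ = x₀ ∧
      ∀ t ∈ Ioo (t₀ - ε) (t₀ + ε), HasDerivAt α (B t (α t)) t := by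
  obtain ⟨C, hC⟩ := (isCompact_Icc (a := t₀ - 1) (b := t₀ + 1)).exists_bound_of_continuousOn
    hB.continuousOn
  set K : NNReal := C.toNNReal
  have hK : ∀ t ∈ Icc (t₀ - 1) (t₀ + 1), ‖B t‖ ≤ K := fun t ht ↦
    (hC t ht).trans (Real.le_coe_toNNReal C)
  set a : NNReal := ‖x₀‖₊ + 1
  set L : NNReal := K * (‖x₀‖₊ + a)
  set ε : ℝ := min 1 (a / (L + 1))
  have ha : (0 : ℝ) < a := by positivity
  have hε : 0 < ε := by positivity
  have hsub : Icc (t₀ - ε) (t₀ + ε) ⊆ Icc (t₀ - 1) (t₀ + 1) :=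
    Icc_subset_Icc (by linarith [min_le_left (1 : ℝ) (a / (L + 1))])
      (by linarith [min_le_left (1 : ℝ) (a / (L + 1))])
  have hpl : IsPicardLindelof (fun t x ↦ B t x) (tmin := t₀ - ε) (tmax := t₀ + ε)
      ⟨t₀, by linarith, by linarith⟩ x₀ a 0 L K :=
    { lipschitzOnWith := fun t ht ↦
        ((B t).lipschitz.weaken (NNReal.coe_le_coe.1 (hK t (hsub ht)))).lipschitzOnWith
      continuousOn := fun x _ ↦ (hB.clm_apply continuous_const).continuousOn
      norm_le := fun t ht x hx ↦ by
        have h1 : ‖x‖ ≤ ‖x₀‖ + a := by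
          have := norm_sub_norm_le x x₀
          rw [mem_closedBall_iff_norm] at hx
          linarith
        calc ‖B t x‖ ≤ ‖B t‖ * ‖x‖ := (B t).le_opNorm x
          _ ≤ K * (‖x₀‖ + a) :=
            mul_le_mul (hK t (hsub ht)) h1 (norm_nonneg _) K.2
          _ = L := by simp [L]
      mul_max_le := by
        have h1 : ε ≤ a / (L + 1) := min_le_right _ _
        have hL : (0 : ℝ) ≤ L := L.2
        rw [le_div_iff₀ (by positivity)] at h1
        simp only [add_sub_cancel_left, sub_sub_cancel, max_self, NNReal.coe_zero, sub_zero]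
        nlinarith }
  obtain ⟨α, h0, hα⟩ := hpl.exists_eq_forall_mem_Icc_hasDerivWithinAt₀
  exact ⟨ε, hε, α, h0, fun t ht ↦
    (hα t (Ioo_subset_Icc_self ht)).hasDerivAt (Icc_mem_nhds ht.1 ht.2)⟩

variable {F : Type*} [NormedAddCommGroup F] [NormedSpace ℝ F]

/-- `Φ` is a fundamental solution of `f' = A f` on the set `s`, with inverse `Ψ`. -/
structure IsFundamentalPair (A Φ Ψ : ℝ → F →L[ℝ] F) (s : Set ℝ) : Prop where
  hasDerivAt : ∀ t ∈ s, HasDerivAt Φ (A t ∘L Φ t) t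
  hasDerivAt_inv : ∀ t ∈ s, HasDerivAt Ψ (-(Ψ t ∘L A t)) t
  inv_apply_apply : ∀ t ∈ s, ∀ v, Ψ t (Φ t v) = v
  apply_inv_apply : ∀ t ∈ s, ∀ v, Φ t (Ψ t v) = v

lemma exists_isFundamentalPair [FiniteDimensional ℝ F] {A : ℝ → F →L[ℝ] F} (hA : Continuous A)
    (t₀ : ℝ) : ∃ ε > 0, ∃ Φ Ψ : ℝ → F →L[ℝ] F,
      IsFundamentalPair A Φ Ψ (Ioo (t₀ - ε) (t₀ + ε)) := by
  have : CompleteSpace F := FiniteDimensional.complete ℝ F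
  obtain ⟨ε₁, hε₁, Φ, hΦ0, hΦ⟩ := exists_hasDerivAt_of_continuous_clm
    (B := fun t ↦ ContinuousLinearMap.compL ℝ F F F (A t)) (by fun_prop) t₀ (.id ℝ F)
  obtain ⟨ε₂, hε₂, Ψ, hΨ0, hΨ⟩ := exists_hasDerivAt_of_continuous_clm
    (B := fun t ↦ -((ContinuousLinearMap.compL ℝ F F F).flip (A t))) (by fun_prop) t₀ (.id ℝ F)
  set ε := min ε₁ ε₂
  have hΦ' : ∀ t ∈ Ioo (t₀ - ε) (t₀ + ε), HasDerivAt Φ (A t ∘L Φ t) t := fun t ht ↦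
    hΦ t ⟨by linarith [ht.1, min_le_left ε₁ ε₂], by linarith [ht.2, min_le_left ε₁ ε₂]⟩
  have hΨ' : ∀ t ∈ Ioo (t₀ - ε) (t₀ + ε), HasDerivAt Ψ (-(Ψ t ∘L A t)) t := fun t ht ↦
    hΨ t ⟨by linarith [ht.1, min_le_right ε₁ ε₂], by linarith [ht.2, min_le_right ε₁ ε₂]⟩
  have hε : 0 < ε := lt_min hε₁ hε₂
  have hd : ∀ t ∈ Ioo (t₀ - ε) (t₀ + ε), HasDerivAt (fun t ↦ Ψ t ∘L Φ t) 0 t := fun t ht ↦ by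
    refine ((hΨ' t ht).clm_comp (hΦ' t ht)).congr_deriv ?_
    ext v
    simp
  have hone : ∀ t ∈ Ioo (t₀ - ε) (t₀ + ε), Ψ t ∘L Φ t = .id ℝ F := fun t ht ↦ by
    have h := isOpen_Ioo.is_const_of_deriv_eq_zero isPreconnected_Ioo
      (fun u hu ↦ (hd u hu).differentiableAt.differentiableWithinAt)
      (fun u hu ↦ (hd u hu).deriv) ht (y := t₀) ⟨by linarith, by linarith⟩
    rw [h, hΦ0, hΨ0]
    rfl
  refine ⟨ε, hε, Φ, Ψ, hΦ', hΨ', fun t ht v ↦ congr($(hone t ht) v), fun t ht v ↦ ?_⟩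
  have h : (Ψ t : F →ₗ[ℝ] F) * (Φ t : F →ₗ[ℝ] F) = 1 :=
    LinearMap.ext fun v ↦ congr($(hone t ht) v)
  exact congr($(mul_eq_one_comm.1 h) v)

lemma IsFundamentalPair.mono {A Φ Ψ : ℝ → F →L[ℝ] F} {s s' : Set ℝ}
    (h : IsFundamentalPair A Φ Ψ s) (hs : s' ⊆ s) : IsFundamentalPair A Φ Ψ s' :=
  ⟨fun t ht ↦ h.1 t (hs ht), fun t ht ↦ h.2 t (hs ht), fun t ht ↦ h.3 t (hs ht),
    fun t ht ↦ h.4 t (hs ht)⟩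

lemma IsFundamentalPair.eq_of_hasDerivAt [CompleteSpace F] {A Φ Ψ : ℝ → F →L[ℝ] F} {a b : ℝ}
    (hab : a ≤ b) (h : IsFundamentalPair A Φ Ψ (Icc a b)) {f : ℝ → F}
    (hf : ContinuousOn f (Icc a b))
    {S : Set ℝ} (hS : S.Countable) (hd : ∀ t ∈ Ioo a b \ S, HasDerivAt f (A t (f t)) t) :
    f b = Φ b (Ψ a (f a)) := by
  have hc : ContinuousOn (fun t ↦ Ψ t (f t)) (Icc a b) :=
    (HasDerivAt.continuousOn h.2).clm_apply hf
  have hint := MeasureTheory.integral_eq_of_hasDerivAt_off_countable_of_le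
    (fun t ↦ Ψ t (f t)) (fun _ ↦ 0) hab hS hc (fun t ht ↦ by
      refine ((h.2 t (Ioo_subset_Icc_self ht.1)).clm_apply (hd t ht)).congr_deriv ?_
      simp) (by simp)
  rw [intervalIntegral.integral_zero, eq_comm, sub_eq_zero] at hint
  rw [← hint, h.4 b (right_mem_Icc.2 hab)]

end LinearODE

section CovDerivTrivialization

variable {E : Type*} [NormedAddCommGroup E] [NormedSpace ℝ E]
  {H : Type*} [TopologicalSpace H] {I : ModelWithCorners ℝ E H}
  {M : Type*} [TopologicalSpace M] [ChartedSpace H M]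

lemma hasDerivAt_comp_velocity {G : Type*} [NormedAddCommGroup G] [NormedSpace ℝ G] {γ : ℝ → M}
    {φ : M → G} {t : ℝ} (hφ : MDiffAt φ (γ t)) (hγ : MDifferentiableAt 𝓘(ℝ, ℝ) I γ t) :
    HasDerivAt (fun u ↦ φ (γ u)) (mvfderiv I φ (γ t) (velocity I γ t)) t :=
  let L : E →L[ℝ] G := mfderiv I 𝓘(ℝ, G) φ (γ t)
  let L' : ℝ →L[ℝ] E := mfderiv 𝓘(ℝ, ℝ) I γ t
  have h : HasMFDerivAt 𝓘(ℝ, ℝ) 𝓘(ℝ, G) (fun u ↦ φ (γ u)) t (L.comp L') :=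
    hφ.hasMFDerivAt.comp t hγ.hasMFDerivAt
  HasFDerivAt.hasDerivAt (f' := L.comp L') (hasMFDerivAt_iff_hasFDerivAt.1 h)

variable {F : Type*} [NormedAddCommGroup F] [NormedSpace ℝ F]
  {V : M → Type*} [TopologicalSpace (TotalSpace F V)]
  [∀ x, AddCommGroup (V x)] [∀ x, Module ℝ (V x)]
  [∀ x : M, TopologicalSpace (V x)] [FiberBundle F V] [VectorBundle ℝ F V]

lemma mdifferentiableAt_trivialization_symm [ContMDiffVectorBundle 1 F V I]
    (e : Trivialization F (π F V)) [MemTrivializationAtlas e] {x : M} (hx : x ∈ e.baseSet) (w : F) :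
    MDifferentiableAt I (I.prod 𝓘(ℝ, F)) (fun y ↦ TotalSpace.mk' F y (e.symm y w)) x := by
  rw [e.mdifferentiableAt_section_iff I _ hx]
  refine (mdifferentiableAt_const (c := w)).congr_of_eventuallyEq ?_
  filter_upwards [e.open_baseSet.mem_nhds hx] with y hy
  exact congrArg Prod.snd (e.apply_mk_symm hy w)

variable [∀ x, IsTopologicalAddGroup (V x)] [∀ x, ContinuousSMul ℝ (V x)]

lemma CovariantDerivative.sum_smul (cov : CovariantDerivative I F V) {ι : Type*} (s : Finset ι)
    {f : ι → M → ℝ} {σ : ι → Π x : M, V x} {x : M} (hf : ∀ i, MDiffAt (f i) x)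
    (hσ : ∀ i, MDifferentiableAt I (I.prod 𝓘(ℝ, F)) (fun y ↦ TotalSpace.mk' F y (σ i y)) x) :
    MDifferentiableAt I (I.prod 𝓘(ℝ, F)) (fun y ↦ TotalSpace.mk' F y ((∑ i ∈ s, f i • σ i) y)) x ∧
    cov (∑ i ∈ s, f i • σ i) x
      = ∑ i ∈ s, (f i x • cov (σ i) x + (mvfderiv I (f i) x).smulRight (σ i x)) := by
  classical
  induction s using Finset.induction_on with
  | empty => exact ⟨mdifferentiableAt_zeroSection .., by simp [cov.zero]⟩
  | insert i s hi ih =>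
    rw [Finset.sum_insert hi, Finset.sum_insert hi,
      cov.isCovariantDerivativeOnUniv.add ((hf i).smul_section (hσ i)) ih.1, ih.2,
      cov.isCovariantDerivativeOnUniv.leibniz (hσ i) (hf i)]
    exact ⟨mdifferentiableAt_add_section ((hf i).smul_section (hσ i)) ih.1, rfl⟩

variable [ContMDiffVectorBundle 1 F V I]

/-- The value of a connection on a section, in terms of a local trivialization. -/
lemma CovariantDerivative.apply_eq_trivialization [FiniteDimensional ℝ F]
    (cov : CovariantDerivative I F V) (e : Trivialization F (π F V)) [MemTrivializationAtlas e]
    {σ : Π x : M, V x} {x : M} (hx : x ∈ e.baseSet)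
    (hσ : MDifferentiableAt I (I.prod 𝓘(ℝ, F)) (fun y ↦ TotalSpace.mk' F y (σ y)) x)
    (u : TangentSpace I x) :
    cov σ x u = e.symm x (mvfderiv I (fun y ↦ (e ⟨y, σ y⟩).2) x u)
      + cov (fun y ↦ e.symm y (e ⟨x, σ x⟩).2) x u := by
  set b := Module.finBasis ℝ F
  let ε := fun i (y : M) ↦ e.symm y (b i)
  have hε i : MDifferentiableAt I (I.prod 𝓘(ℝ, F)) (fun y ↦ TotalSpace.mk' F y (ε i y)) x :=
    mdifferentiableAt_trivialization_symm e hx (b i)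
  let φ := fun y ↦ (e ⟨y, σ y⟩).2
  have hφ : MDiffAt φ x := (e.mdifferentiableAt_section_iff I σ hx).1 hσ
  let ℓ i : F →L[ℝ] ℝ := LinearMap.toContinuousLinearMap (b.coord i)
  have hℓ i : HasMFDerivAt I 𝓘(ℝ, ℝ) (fun y ↦ ℓ i (φ y)) x ((ℓ i).comp (mvfderiv I φ x)) :=
    (ℓ i).hasMFDerivAt.comp x hφ.hasMFDerivAt
  have hsymm (y : M) (hy : y ∈ e.baseSet) (w : F) : e.symm y w = ∑ i, ℓ i w • ε i y := by
    conv_lhs => rw [← b.sum_repr w]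
    simp only [ε, ← Trivialization.symmₗ_apply (R := ℝ) _ hy, map_sum, map_smul]
    rfl
  have h1 := cov.sum_smul Finset.univ (f := fun i y ↦ ℓ i (φ y)) (fun i ↦ (hℓ i).mdifferentiableAt)
    hε
  have h2 := cov.sum_smul Finset.univ (f := fun i (_ : M) ↦ ℓ i (φ x))
    (fun i ↦ mdifferentiableAt_const)
    hε
  have e1 : cov σ x = cov (∑ i, (fun y ↦ ℓ i (φ y)) • ε i) x := by
    refine cov.isCovariantDerivativeOnUniv.congr_of_eventuallyEq hσ h1.1 Filter.univ_mem ?_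
    filter_upwards [e.open_baseSet.mem_nhds hx] with y hy
    rw [Finset.sum_apply]
    exact (e.symm_apply_apply_mk hy (σ y)).symm.trans (hsymm y hy _)
  have e2 : cov (fun y ↦ e.symm y (φ x)) x = cov (∑ i, (fun _ : M ↦ ℓ i (φ x)) • ε i) x := by
    refine cov.isCovariantDerivativeOnUniv.congr_of_eventuallyEq
      (mdifferentiableAt_trivialization_symm e hx _) h2.1 Filter.univ_mem ?_
    filter_upwards [e.open_baseSet.mem_nhds hx] with y hy
    rw [Finset.sum_apply]
    exact hsymm y hy _
  have h3 i : mvfderiv I (fun y ↦ ℓ i (φ y)) x u = ℓ i (mvfderiv I φ x u) :=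
    congrArg (fun L : E →L[ℝ] ℝ ↦ L u) (hℓ i).mfderiv
  change cov σ x u = e.symm x (mvfderiv I φ x u) + cov (fun y ↦ e.symm y (φ x)) x u
  rw [e1, e2, h1.2, h2.2, hsymm x hx]
  simp only [sum_apply, add_apply, smul_apply, ContinuousLinearMap.smulRight_apply, h3,
    mvfderiv_const,
    zero_apply, zero_smul, Finset.sum_const_zero, add_zero, Finset.sum_add_distrib]
  rw [add_comm]

/-- The covariant derivative along a curve, in terms of a local trivialization. -/
lemma covDerivAlong_eq_trivialization [IsManifold I 1 M] [FiniteDimensional ℝ F]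
    (cov : CovariantDerivative I F V) (e : Trivialization F (π F V)) [MemTrivializationAtlas e]
    {c : ℝ → TotalSpace F V} {t : ℝ}
    (hc : MDifferentiableAt 𝓘(ℝ, ℝ) (I.prod 𝓘(ℝ, F)) c t) (ht : (c t).proj ∈ e.baseSet) :
    covDerivAlong cov c t = e.symm (c t).proj (deriv (fun u ↦ (e (c u)).2) t)
      + cov (fun y ↦ e.symm y (e (c t)).2) (c t).proj (velocity I (fun u ↦ (c u).proj) t) := by
  set x := (c t).proj with hxdef
  set e' := trivializationAt F V x with he'
  have hx' : x ∈ e'.baseSet := FiberBundle.mem_baseSet_trivializationAt' x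
  set w := (e (c t)).2 with hw
  have hγ := ((e.mdifferentiableAt_totalSpace_iff I c (e.mem_source.2 ht)).1 hc).1
  have hf := ((e.mdifferentiableAt_totalSpace_iff I c
    (e.mem_source.2 ht)).1 hc).2.differentiableAt.hasDerivAt
  have key := cov.apply_eq_trivialization e' hx' (mdifferentiableAt_trivialization_symm e ht w)
    (velocity I (fun u ↦ (c u).proj) t)
  have hew : (e' ⟨x, e.symm x w⟩).2 = (e' (c t)).2 :=
    congrArg (fun v ↦ (e' ⟨x, v⟩).2) (e.symm_apply_apply_mk ht (c t).2)
  rw [hew] at key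
  have hT : MDiffAt (fun y ↦ (e.coordChangeL ℝ e' y : F →L[ℝ] F)) x :=
    (mdifferentiableOn_coordChangeL e e' x ⟨ht, hx'⟩).mdifferentiableAt
      ((e.open_baseSet.inter e'.open_baseSet).mem_nhds ⟨ht, hx'⟩)
  have hTγ := hasDerivAt_comp_velocity (γ := fun u ↦ (c u).proj) (t := t) hT hγ
  have hd := hTγ.clm_apply hf
  have hmem : ∀ᶠ y in 𝓝 x, y ∈ e.baseSet ∩ e'.baseSet :=
    (e.open_baseSet.inter e'.open_baseSet).mem_nhds ⟨ht, hx'⟩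
  have hTw : MDiffAt (fun y ↦ (e' ⟨y, e.symm y w⟩).2) x :=
    (e'.mdifferentiableAt_section_iff I _ hx').1 (mdifferentiableAt_trivialization_symm e ht w)
  have hTwγ := hasDerivAt_comp_velocity (γ := fun u ↦ (c u).proj) (t := t) hTw hγ
  have e1 : mvfderiv I (fun y ↦ (e' ⟨y, e.symm y w⟩).2) x (velocity I (fun u ↦ (c u).proj) t)
      = (mvfderiv I (fun y ↦ (e.coordChangeL ℝ e' y : F →L[ℝ] F)) x
        (velocity I (fun u ↦ (c u).proj) t)) w := by
    refine hTwγ.unique ((hTγ.clm_apply (hasDerivAt_const t w)).congr_deriv (by simp; rfl)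
      |>.congr_of_eventuallyEq ?_)
    filter_upwards [hγ.continuousAt.eventually hmem] with u hu
    exact (Trivialization.coordChangeL_apply e e' hu w).symm
  have e2 : deriv (fun u ↦ (e' (c u)).2) t
      = (mvfderiv I (fun y ↦ (e.coordChangeL ℝ e' y : F →L[ℝ] F)) x
        (velocity I (fun u ↦ (c u).proj) t)) w
        + (e.coordChangeL ℝ e' x : F →L[ℝ] F) (deriv (fun u ↦ (e (c u)).2) t) := by
    refine (hd.congr_of_eventuallyEq ?_).deriv
    filter_upwards [hγ.continuousAt.eventually hmem] with u hu
    refine Eq.trans ?_ (Trivialization.coordChangeL_apply e e' hu _).symm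
    exact congrArg (fun v ↦ (e' ⟨(c u).proj, v⟩).2) (e.symm_apply_apply_mk hu.1 (c u).2).symm
  have e3 : e'.symm x ((e.coordChangeL ℝ e' x : F →L[ℝ] F) (deriv (fun u ↦ (e (c u)).2) t))
      = e.symm x (deriv (fun u ↦ (e (c u)).2) t) := by
    refine Eq.trans ?_ (e'.symm_apply_apply_mk hx' _)
    exact congrArg (e'.symm x) (Trivialization.coordChangeL_apply e e' ⟨ht, hx'⟩ _)
  have hadd (a b : F) : e'.symm x (a + b) = e'.symm x a + e'.symm x b := by
    simpa only [Trivialization.symmₗ_apply _ hx'] using (e'.symmₗ ℝ x).map_add a b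
  rw [key, e1]
  change e'.symm x (deriv (fun u ↦ (e' (c u)).2) t) + cov (fun y ↦ e'.symm y (e' (c t)).2) x _ = _
  rw [e2, hadd, e3]
  abel

end CovDerivTrivialization

section LeviCivitaContinuity

variable {E : Type*} [NormedAddCommGroup E] [NormedSpace ℝ E]
  {H : Type*} [TopologicalSpace H] {I : ModelWithCorners ℝ E H}
  {M : Type*} [TopologicalSpace M] [ChartedSpace H M] [IsManifold I ∞ M]

lemma continuousOn_mvfderiv_apply {f : M → ℝ} {X : Π x : M, TangentSpace I x} {s : Set M}
    (hs : IsOpen s) (hf : ContMDiffOn I 𝓘(ℝ, ℝ) ∞ f s)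
    (hX : ContinuousOn (fun y ↦ TotalSpace.mk' E y (X y)) s) :
    ContinuousOn (fun y ↦ mvfderiv I f y (X y)) s := by
  have h := (hf.continuousOn_tangentMapWithin (by simp) hs.uniqueMDiffOn).comp hX
    (fun y hy ↦ hy)
  intro y hy
  have h2 := ((FiberBundle.continuousWithinAt_totalSpace ℝ _).1 (h y hy)).2
  refine h2.congr (fun z hz ↦ ?_) ?_
  all_goals
    simp [tangentMapWithin, mvfderiv, mfderivWithin_of_isOpen hs, *]
    rfl

lemma contMDiffAt_trivialization_symm (e : Trivialization E (π E (TangentSpace I : M → Type _)))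
    [MemTrivializationAtlas e] {x : M} (hx : x ∈ e.baseSet) (w : E) :
    ContMDiffAt I (I.prod 𝓘(ℝ, E)) ∞
      (fun y ↦ TotalSpace.mk' E y (e.symm y w : TangentSpace I y)) x := by
  rw [e.contMDiffAt_section_iff hx]
  refine (contMDiffAt_const (c := w)).congr_of_eventuallyEq ?_
  filter_upwards [e.open_baseSet.mem_nhds hx] with y hy
  exact congrArg Prod.snd (e.apply_mk_symm hy w)

namespace SmoothMetric

lemma contMDiffAt_pair (g : SmoothMetric I M) {n : ℕ∞} {X Y : Π x : M, TangentSpace I x} {x : M}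
    (hX : ContMDiffAt I (I.prod 𝓘(ℝ, E)) n (fun y ↦ TotalSpace.mk' E y (X y)) x)
    (hY : ContMDiffAt I (I.prod 𝓘(ℝ, E)) n (fun y ↦ TotalSpace.mk' E y (Y y)) x) :
    ContMDiffAt I 𝓘(ℝ, ℝ) n (g.pair X Y) x := by
  have h := (g.contMDiff x).of_le (m := n) (by exact_mod_cast le_top)
  have := ContMDiffAt.clm_bundle_apply₂ (E₃ := Bundle.Trivial M ℝ) (F₃ := ℝ)
    (b := fun m : M ↦ m) h hX hY
  rw [contMDiffAt_totalSpace] at this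
  exact this.2

variable [FiniteDimensional ℝ E]

lemma continuousOn_koszul (g : SmoothMetric I M) {X Y Z : Π x : M, TangentSpace I x} {s : Set M}
    (hs : IsOpen s)
    (hX : ContMDiffOn I (I.prod 𝓘(ℝ, E)) ∞ (fun y ↦ TotalSpace.mk' E y (X y)) s)
    (hY : ContMDiffOn I (I.prod 𝓘(ℝ, E)) ∞ (fun y ↦ TotalSpace.mk' E y (Y y)) s)
    (hZ : ContMDiffOn I (I.prod 𝓘(ℝ, E)) ∞ (fun y ↦ TotalSpace.mk' E y (Z y)) s) :
    ContinuousOn (g.koszul X Y Z) s := by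
  have : CompleteSpace E := FiniteDimensional.complete ℝ E
  have : IsManifold I ((1 : ℕ∞) + 1) M :=
    IsManifold.of_le (m := (1 : ℕ∞) + 1) (n := ∞) (by exact_mod_cast le_top)
  have : IsManifold I (minSmoothness ℝ 2) M :=
    IsManifold.of_le (n := ∞) (by simpa using! WithTop.coe_le_coe.2 (le_top (a := (2 : ℕ∞))))
  have hat {V : Π x : M, TangentSpace I x}
      (hV : ContMDiffOn I (I.prod 𝓘(ℝ, E)) ∞ (fun y ↦ TotalSpace.mk' E y (V y)) s) {x : M}
      (hx : x ∈ s) := (hV x hx).contMDiffAt (hs.mem_nhds hx)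
  have hd {U V W : Π x : M, TangentSpace I x}
      (hU : ContMDiffOn I (I.prod 𝓘(ℝ, E)) ∞ (fun y ↦ TotalSpace.mk' E y (U y)) s)
      (hV : ContMDiffOn I (I.prod 𝓘(ℝ, E)) ∞ (fun y ↦ TotalSpace.mk' E y (V y)) s)
      (hW : ContMDiffOn I (I.prod 𝓘(ℝ, E)) ∞ (fun y ↦ TotalSpace.mk' E y (W y)) s) :
      ContinuousOn (fun x ↦ mvfderiv I (g.pair U V) x (W x)) s :=
    continuousOn_mvfderiv_apply hs
      (fun x hx ↦ (g.contMDiffAt_pair (n := ⊤) (hat hU hx) (hat hV hx)).contMDiffWithinAt)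
      hW.continuousOn
  have hb {U V W : Π x : M, TangentSpace I x}
      (hU : ContMDiffOn I (I.prod 𝓘(ℝ, E)) ∞ (fun y ↦ TotalSpace.mk' E y (U y)) s)
      (hV : ContMDiffOn I (I.prod 𝓘(ℝ, E)) ∞ (fun y ↦ TotalSpace.mk' E y (V y)) s)
      (hW : ContMDiffOn I (I.prod 𝓘(ℝ, E)) ∞ (fun y ↦ TotalSpace.mk' E y (W y)) s) :
      ContinuousOn (fun x ↦ g.inner x (VectorField.mlieBracket I U V x) (W x)) s := fun x hx ↦ by
    have h := ContMDiffAt.mlieBracket_vectorField (m := 0) (n := 1)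
      ((hat hU hx).of_le (by exact_mod_cast le_top)) ((hat hV hx).of_le (by exact_mod_cast le_top))
      (by simp)
    exact (g.contMDiffAt_pair (n := 0) h
      ((hat hW hx).of_le (by exact_mod_cast le_top))).continuousAt.continuousWithinAt
  exact (((((hd hY hZ hX).add (hd hX hZ hY)).sub (hd hX hY hZ)).add (hb hX hY hZ)).sub
    (hb hX hZ hY)).sub (hb hY hZ hX)

/-- The connection coefficients of the Levi-Civita connection in a local trivialization are
continuous. -/
lemma continuousOn_leviCivita_trivialization (g : SmoothMetric I M)
    (e : Trivialization E (π E (TangentSpace I : M → Type _))) [MemTrivializationAtlas e]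
    (w ξ : E) :
    ContinuousOn (fun y ↦ (e ⟨y, g.leviCivita (fun z ↦ e.symm z w) y (e.symm y ξ)⟩).2)
      e.baseSet := by
  have : CompleteSpace E := FiniteDimensional.complete ℝ E
  let σ (v : E) (y : M) : TangentSpace I y := e.symm y v
  have hσ (v : E) {x : M} (hx : x ∈ e.baseSet) := contMDiffAt_trivialization_symm (I := I) e hx v
  have hσd (v : E) {x : M} (hx : x ∈ e.baseSet) := (hσ v hx).mdifferentiableAt (by simp)
  have hσ' (v : E) := fun x (hx : x ∈ e.baseSet) ↦ (hσ v hx).contMDiffWithinAt (s := e.baseSet)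
  let G (y : M) : E →L[ℝ] E →L[ℝ] ℝ :=
    (ContinuousLinearMap.precomp ℝ (e.symmL ℝ y : E →L[ℝ] E)).comp
      ((show E →L[ℝ] E →L[ℝ] ℝ from g.inner y).comp (e.symmL ℝ y : E →L[ℝ] E))
  have hG (y : M) (hy : y ∈ e.baseSet) (a b : E) : G y a b = g.pair (σ a) (σ b) y := by
    change g.inner y (e.symmL ℝ y a) (e.symmL ℝ y b) = g.inner y (e.symm y a) (e.symm y b)
    rw [e.symmL_apply hy, e.symmL_apply hy]
  let c (y : M) : E := (e ⟨y, g.leviCivita (σ w) y (σ ξ y)⟩).2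
  have hc (y : M) (hy : y ∈ e.baseSet) (v : E) :
      G y (c y) v = 1 / 2 * g.koszul (σ ξ) (σ w) (σ v) y := by
    rw [hG y hy, ← g.inner_leviCivita (hσd ξ hy) (hσd w hy) (hσd v hy)]
    exact congrArg (fun u ↦ g.inner y u (σ v y)) (e.symm_apply_apply_mk hy _)
  have hGinj (y : M) (hy : y ∈ e.baseSet) : Function.Injective (G y) := by
    rw [injective_iff_map_eq_zero]
    intro a ha
    by_contra h0
    have h1 : σ a y ≠ 0 := fun h ↦ h0 (by
      have h2 := congrArg Prod.snd (e.apply_mk_symm hy a)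
      have h3 := ((e.linearMapAt ℝ y).map_zero)
      rw [e.coe_linearMapAt_of_mem hy] at h3
      refine h2.symm.trans (Eq.trans ?_ h3)
      exact congrArg (fun v ↦ (e ⟨y, v⟩).2) h)
    have h2 := g.pos y _ h1
    have h3 := hG y hy a a
    rw [ha] at h3
    exact h2.ne h3
  intro x hx
  have hfr : Module.finrank ℝ E = Module.finrank ℝ (E →L[ℝ] ℝ) := by
    rw [← (LinearMap.toContinuousLinearMap (𝕜 := ℝ) (E := E) (F' := ℝ)).finrank_eq]
    exact (Subspace.dual_finrank_eq (K := ℝ) (V := E)).symm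
  have : FiniteDimensional ℝ (E →L[ℝ] ℝ) :=
    (LinearMap.toContinuousLinearMap (𝕜 := ℝ) (E := E) (F' := ℝ)).finiteDimensional
  let L (y : M) (hy : y ∈ e.baseSet) : E ≃L[ℝ] (E →L[ℝ] ℝ) :=
    (LinearEquiv.ofBijective (G y).toLinearMap ⟨hGinj y hy,
      (LinearMap.injective_iff_surjective_of_finrank_eq_finrank hfr).1
        (hGinj y hy)⟩).toContinuousLinearEquiv
  have hL (y : M) (hy : y ∈ e.baseSet) : (L y hy : E →L[ℝ] E →L[ℝ] ℝ) = G y := rfl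
  have hGc : ContinuousAt G x :=
    (contMDiffAt_clm_of_apply (I := I) fun a ↦ contMDiffAt_clm_of_apply fun b ↦
      (g.contMDiffAt_pair (n := ⊤) (hσ a hx) (hσ b hx)).congr_of_eventuallyEq
      (by filter_upwards [e.open_baseSet.mem_nhds hx] with y hy using hG y hy a b)).continuousAt
  have hinv : ContinuousAt (fun y ↦ (G y).inverse) x := by
    have := (contDiffAt_map_inverse (n := 0) (L x hx)).continuousAt
    rw [hL x hx] at this
    exact ContinuousAt.comp this hGc
  have hφ : ContinuousAt (fun y ↦ G y (c y)) x := by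
    rw [continuousAt_clm_apply]
    intro v
    refine (((g.continuousOn_koszul e.open_baseSet (hσ' ξ) (hσ' w) (hσ' v)).continuousAt
      (e.open_baseSet.mem_nhds hx)).const_mul (1 / 2)).congr ?_
    filter_upwards [e.open_baseSet.mem_nhds hx] with y hy using (hc y hy v).symm
  refine ((hinv.clm_apply hφ).congr ?_).continuousWithinAt
  filter_upwards [e.open_baseSet.mem_nhds hx] with y hy
  rw [← hL y hy, ContinuousLinearMap.inverse_equiv]
  exact (L y hy).symm_apply_apply (c y)

end SmoothMetric

end LeviCivitaContinuity

section TransportOn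

variable {E : Type*} [NormedAddCommGroup E] [NormedSpace ℝ E]
  {H : Type*} [TopologicalSpace H] {I : ModelWithCorners ℝ E H}
  {M : Type*} [TopologicalSpace M] [ChartedSpace H M]
  {F : Type*} [NormedAddCommGroup F] [NormedSpace ℝ F]
  {V : M → Type*} [TopologicalSpace (TotalSpace F V)]
  [∀ x, AddCommGroup (V x)] [∀ x, Module ℝ (V x)]
  [∀ x : M, TopologicalSpace (V x)]
  [∀ x, IsTopologicalAddGroup (V x)] [∀ x, ContinuousSMul ℝ (V x)]
  [FiberBundle F V]

/-- There is a parallel vector field along `γ` on `[a, b]` with value `v` at time `a` and value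
`w` at time `b`. -/
def TransportsOn (cov : CovariantDerivative I F V) (γ : ℝ → M) (a b : ℝ) {x y : M} (v : V x)
    (w : V y) : Prop :=
  ∃ c : ℝ → TotalSpace F V, ContinuousOn c (Icc a b) ∧
    (∃ S : Set ℝ, S.Finite ∧ ∀ t ∈ Ioo a b \ S, IsParallelAt cov c t) ∧
    (∀ t ∈ Icc a b, (c t).proj = γ t) ∧ c a = TotalSpace.mk' F x v ∧ c b = TotalSpace.mk' F y w

/-- Parallel transport along `γ` from time `a` to time `b` is a well-defined linear
isomorphism. -/
def HasTransportOn (cov : CovariantDerivative I F V) (γ : ℝ → M) (a b : ℝ) : Prop :=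
  ∃ L : V (γ a) ≃ₗ[ℝ] V (γ b), ∀ v w, TransportsOn cov γ a b v w ↔ w = L v

variable {cov : CovariantDerivative I F V} {γ : ℝ → M}

lemma transportsOn_zero_one {x y : M} {v : V x} {w : V y} :
    TransportsOn cov γ 0 1 v w ↔ Transports cov γ v w := by
  simp only [TransportsOn, Transports, IsParallel, and_assoc]

lemma HasTransportOn.refl (cov : CovariantDerivative I F V) (γ : ℝ → M) (a : ℝ) :
    HasTransportOn cov γ a a := by
  refine ⟨LinearEquiv.refl ℝ _, fun v w ↦ ⟨?_, ?_⟩⟩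
  · rintro ⟨c, -, -, -, h0, h1⟩
    exact TotalSpace.mk_injective (F := F) _ (h1.symm.trans h0)
  · rintro rfl
    exact ⟨fun _ ↦ TotalSpace.mk' F (γ a) w, continuousOn_const, ⟨∅, finite_empty, by simp⟩,
      fun t ht ↦ by rw [show t = a by simpa using ht], rfl, rfl⟩

lemma transportsOn_trans_iff {a b d : ℝ} (hab : a ≤ b) (hbd : b ≤ d) {x z : M} {v : V x} {w : V z} :
    TransportsOn cov γ a d v w ↔
      ∃ u : V (γ b), TransportsOn cov γ a b v u ∧ TransportsOn cov γ b d u w := by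
  constructor
  · rintro ⟨c, hc, ⟨S, hS, hp⟩, hpr, h0, h1⟩
    obtain ⟨u, hu⟩ : ∃ u : V (γ b), c b = TotalSpace.mk' F (γ b) u := by
      rw [← hpr b ⟨hab, hbd⟩]
      exact ⟨(c b).2, rfl⟩
    exact ⟨u, ⟨c, hc.mono (Icc_subset_Icc_right hbd),
      ⟨S, hS, fun t ht ↦ hp t ⟨Ioo_subset_Ioo_right hbd ht.1, ht.2⟩⟩,
      fun t ht ↦ hpr t (Icc_subset_Icc_right hbd ht), h0, hu⟩,
      ⟨c, hc.mono (Icc_subset_Icc_left hab),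
      ⟨S, hS, fun t ht ↦ hp t ⟨Ioo_subset_Ioo_left hab ht.1, ht.2⟩⟩,
      fun t ht ↦ hpr t (Icc_subset_Icc_left hab ht), hu, h1⟩⟩
  · rintro ⟨u, ⟨c₁, hc₁, ⟨S₁, hS₁, hp₁⟩, hpr₁, h01, h11⟩, ⟨c₂, hc₂, ⟨S₂, hS₂, hp₂⟩, hpr₂, h02, h12⟩⟩
    have hcc : c₁ b = c₂ b := h11.trans h02.symm
    let c : ℝ → TotalSpace F V := fun t ↦ if t ≤ b then c₁ t else c₂ t
    have hl : EqOn c c₁ (Iic b) := fun t ht ↦ if_pos ht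
    have hr : EqOn c c₂ (Ici b) := fun t ht ↦ by
      rcases eq_or_lt_of_le (mem_Ici.1 ht) with rfl | h
      · simp [c, hcc]
      · exact if_neg (not_le.2 h)
    refine ⟨c, ?_, ⟨S₁ ∪ S₂ ∪ {b}, (hS₁.union hS₂).union (finite_singleton b), ?_⟩, ?_,
      (hl hab).trans h01, (hr hbd).trans h12⟩
    · rw [← Icc_union_Icc_eq_Icc hab hbd]
      exact (hc₁.congr (hl.mono Icc_subset_Iic_self)).union_of_isClosed
        (hc₂.congr (hr.mono Icc_subset_Ici_self)) isClosed_Icc isClosed_Icc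
    · rintro t ⟨ht, htS⟩
      simp only [mem_union, mem_singleton_iff, not_or] at htS
      rcases lt_or_gt_of_ne htS.2 with h | h
      · refine (hp₁ t ⟨⟨ht.1, h⟩, htS.1.1⟩).congr ?_
        filter_upwards [Iio_mem_nhds h] with u hu
        exact (hl (mem_Iio.1 hu).le).symm
      · refine (hp₂ t ⟨⟨h, ht.2⟩, htS.1.2⟩).congr ?_
        filter_upwards [Ioi_mem_nhds h] with u hu
        exact (hr (mem_Ioi.1 hu).le).symm
    · intro t ht
      rcases le_total t b with h | h
      · rw [hl h]
        exact hpr₁ t ⟨ht.1, h⟩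
      · rw [hr h]
        exact hpr₂ t ⟨h, ht.2⟩

lemma HasTransportOn.trans {a b d : ℝ} (hab : a ≤ b) (hbd : b ≤ d)
    (h₁ : HasTransportOn cov γ a b) (h₂ : HasTransportOn cov γ b d) : HasTransportOn cov γ a d := by
  obtain ⟨L₁, hL₁⟩ := h₁
  obtain ⟨L₂, hL₂⟩ := h₂
  refine ⟨L₁.trans L₂, fun v w ↦ ?_⟩
  simp [transportsOn_trans_iff hab hbd, hL₁, hL₂]

end TransportOn

/-- An induction principle: a reflexive and transitive relation between times which holds between
each time and all nearby times holds between the end points of an interval. -/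
lemma rel_zero_one_of_local {P : ℝ → ℝ → Prop} (hrefl : P 0 0)
    (htrans : ∀ a b c, a ≤ b → b ≤ c → P a b → P b c → P a c)
    (hr : ∀ t ∈ Ico (0 : ℝ) 1, ∃ ε > 0, ∀ s ∈ Ioo t (t + ε), P t s)
    (hl : ∀ t ∈ Ioc (0 : ℝ) 1, ∃ ε > 0, ∀ s ∈ Ioo (t - ε) t, P s t) : P 0 1 := by
  let T : Set ℝ := {t ∈ Icc (0 : ℝ) 1 | P 0 t}
  have h0 : (0 : ℝ) ∈ T := ⟨by simp, hrefl⟩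
  have hb : BddAbove T := ⟨1, fun t ht ↦ ht.1.2⟩
  have hu0 : 0 ≤ sSup T := le_csSup hb h0
  have hu1 : sSup T ≤ 1 := csSup_le ⟨0, h0⟩ fun t ht ↦ ht.1.2
  have huT : P 0 (sSup T) := by
    rcases eq_or_lt_of_le hu0 with h | h
    · rwa [← h]
    · obtain ⟨ε, hε, hP⟩ := hl _ ⟨h, hu1⟩
      obtain ⟨t, ht, htu⟩ := exists_lt_of_lt_csSup ⟨0, h0⟩ (sub_lt_self (sSup T) hε)
      rcases eq_or_lt_of_le (le_csSup hb ht) with h' | h'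
      · rw [← h']
        exact ht.2
      · exact htrans _ _ _ ht.1.1 h'.le ht.2 (hP t ⟨htu, h'⟩)
  rcases eq_or_lt_of_le hu1 with h | h
  · rwa [h] at huT
  · obtain ⟨ε, hε, hP⟩ := hr _ ⟨hu0, h⟩
    obtain ⟨s, hs1, hs2⟩ := exists_between (lt_min (lt_add_of_pos_right (sSup T) hε) h)
    have : s ∈ T := ⟨⟨hu0.trans hs1.le, hs2.le.trans (min_le_right _ _)⟩,
      htrans _ _ _ hu0 hs1.le huT (hP s ⟨hs1, hs2.trans_le (min_le_left _ _)⟩)⟩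
    exact absurd (le_csSup hb this) (not_le.2 hs1)

section ParallelTransport

variable {E : Type*} [NormedAddCommGroup E] [NormedSpace ℝ E]
  {H : Type*} [TopologicalSpace H] {I : ModelWithCorners ℝ E H}
  {M : Type*} [TopologicalSpace M] [ChartedSpace H M] [IsManifold I ∞ M]

/-- The connection coefficients `(w, ξ) ↦ ∇_ξ w` in a local trivialization, as a linear function of
`ξ`. -/
def connectionCoeff (cov : CovariantDerivative I E (TangentSpace I : M → Type _))
    (e : Trivialization E (π E (TangentSpace I : M → Type _))) [MemTrivializationAtlas e]
    (y : M) (w : E) : E →L[ℝ] E :=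
  (e.continuousLinearMapAt ℝ y : E →L[ℝ] E) ∘L
    (cov (fun z ↦ e.symm z w) y : E →L[ℝ] E) ∘L (e.symmL ℝ y : E →L[ℝ] E)

lemma connectionCoeff_apply (cov : CovariantDerivative I E (TangentSpace I : M → Type _))
    (e : Trivialization E (π E (TangentSpace I : M → Type _))) [MemTrivializationAtlas e]
    {y : M} (hy : y ∈ e.baseSet) (w ξ : E) :
    connectionCoeff cov e y w ξ = (e ⟨y, cov (fun z ↦ e.symm z w) y (e.symm y ξ)⟩).2 := by
  change e.continuousLinearMapAt ℝ y (cov (fun z ↦ e.symm z w) y (e.symmL ℝ y ξ)) = _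
  rw [e.symmL_apply hy]
  exact congrFun (e.coe_linearMapAt_of_mem (R := ℝ) hy) _

variable [FiniteDimensional ℝ E]

lemma connectionCoeff_eq_sum (cov : CovariantDerivative I E (TangentSpace I : M → Type _))
    (e : Trivialization E (π E (TangentSpace I : M → Type _))) [MemTrivializationAtlas e]
    {y : M} (hy : y ∈ e.baseSet) (w : E) :
    connectionCoeff cov e y w = ∑ i, (Module.finBasis ℝ E).coord i w •
      connectionCoeff cov e y (Module.finBasis ℝ E i) := by
  have hσ (w : E) := mdifferentiableAt_trivialization_symm (I := I) e hy w
  let ℓ : E →ₗ[ℝ] E →L[ℝ] E :=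
    { toFun w := connectionCoeff cov e y w
      map_add' w w' := by
        have h : cov (fun z ↦ e.symm z (w + w')) y
            = cov ((fun z ↦ e.symm z w) + fun z ↦ e.symm z w') y := by
          refine cov.isCovariantDerivativeOnUniv.congr_of_eventuallyEq (hσ _)
            (mdifferentiableAt_add_section (hσ w) (hσ w')) Filter.univ_mem ?_
          filter_upwards [e.open_baseSet.mem_nhds hy] with z hz
          change e.symm z (w + w') = e.symm z w + e.symm z w'
          simpa only [Trivialization.symmₗ_apply _ hz] using (e.symmₗ ℝ z).map_add w w'
        rw [cov.isCovariantDerivativeOnUniv.add (hσ w) (hσ w')] at h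
        refine ContinuousLinearMap.ext fun ξ ↦ ?_
        change e.continuousLinearMapAt ℝ y (cov _ y _) = e.continuousLinearMapAt ℝ y (cov _ y _)
          + e.continuousLinearMapAt ℝ y (cov _ y _)
        rw [h, ← map_add]
        rfl
      map_smul' r w := by
        have h : cov (fun z ↦ e.symm z (r • w)) y = cov (r • fun z ↦ e.symm z w) y := by
          refine cov.isCovariantDerivativeOnUniv.congr_of_eventuallyEq (hσ _)
            (mdifferentiableAt_const.smul_section (f := fun _ ↦ r) (hσ w)) Filter.univ_mem ?_
          filter_upwards [e.open_baseSet.mem_nhds hy] with z hz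
          change e.symm z (r • w) = r • e.symm z w
          simpa only [Trivialization.symmₗ_apply _ hz] using (e.symmₗ ℝ z).map_smul r w
        rw [cov.isCovariantDerivativeOnUniv.smul_const r (hσ w)] at h
        refine ContinuousLinearMap.ext fun ξ ↦ ?_
        change e.continuousLinearMapAt ℝ y (cov _ y _) = r • e.continuousLinearMapAt ℝ y (cov _ y _)
        rw [h, ← map_smul]
        rfl }
  change ℓ w = ∑ i, (Module.finBasis ℝ E).coord i w • ℓ (Module.finBasis ℝ E i)
  conv_lhs => rw [← (Module.finBasis ℝ E).sum_repr w]
  rw [map_sum]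
  simp only [map_smul]
  rfl

lemma isParallelAt_iff_hasDerivAt (cov : CovariantDerivative I E (TangentSpace I : M → Type _))
    (x : M) {c : ℝ → TangentBundle I M} {t : ℝ}
    (ht : (c t).proj ∈ (trivializationAt E (TangentSpace I) x).baseSet)
    (hγ : MDifferentiableAt 𝓘(ℝ, ℝ) I (fun u ↦ (c u).proj) t) :
    IsParallelAt cov c t ↔ HasDerivAt (fun u ↦ (trivializationAt E (TangentSpace I) x (c u)).2)
      (-connectionCoeff cov (trivializationAt E (TangentSpace I) x) (c t).proj
        (trivializationAt E (TangentSpace I) x (c t)).2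
        (deriv (fun u ↦ extChartAt I x (c u).proj) t)) t := by
  set e := trivializationAt E (TangentSpace I : M → Type _) x with he
  set f := fun u ↦ (e (c u)).2 with hf
  have hv : e.symm (c t).proj (deriv (fun u ↦ extChartAt I x (c u).proj) t)
      = velocity I (fun u ↦ (c u).proj) t := by
    have h1 := hasDerivAt_comp_velocity (γ := fun u ↦ (c u).proj)
      (mdifferentiableAt_extChartAt (I := I) (x := x) ht) hγ
    rw [h1.deriv]
    have h2 := TangentBundle.continuousLinearMapAt_trivializationAt (I := I) ht
    have h3 := e.symmL_continuousLinearMapAt (R := ℝ) ht (velocity I (fun u ↦ (c u).proj) t)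
    rw [e.symmL_apply ht] at h3
    refine Eq.trans ?_ h3
    exact congrArg (fun L : E →L[ℝ] E ↦ e.symm (c t).proj (L (velocity I (fun u ↦ (c u).proj) t)))
      h2.symm
  have hiff : MDifferentiableAt 𝓘(ℝ, ℝ) (I.prod 𝓘(ℝ, E)) c t ↔ DifferentiableAt ℝ f t := by
    rw [e.mdifferentiableAt_totalSpace_iff I c (e.mem_source.2 ht), and_iff_right hγ]
    exact mdifferentiableAt_iff_differentiableAt
  have hsymm (z : E) : (e ⟨(c t).proj, e.symm (c t).proj z⟩).2 = z :=
    congrArg Prod.snd (e.apply_mk_symm ht z)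
  have hcov (hc : MDifferentiableAt 𝓘(ℝ, ℝ) (I.prod 𝓘(ℝ, E)) c t) : covDerivAlong cov c t = 0 ↔
      deriv f t = -connectionCoeff cov e (c t).proj (f t)
        (deriv (fun u ↦ extChartAt I x (c u).proj) t) := by
    rw [covDerivAlong_eq_trivialization cov e hc ht, connectionCoeff_apply cov e ht, hv]
    rw [← (e.continuousLinearEquivAt ℝ (c t).proj ht).map_eq_zero_iff, map_add,
      ← add_eq_zero_iff_eq_neg]
    have h1 : (e.continuousLinearEquivAt ℝ (c t).proj ht) (e.symm (c t).proj (deriv f t))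
      = deriv f t := hsymm _
    exact Iff.of_eq (congrArg (fun z : E ↦ z + _ = 0) h1)
  constructor
  · rintro ⟨hc, h0⟩
    rw [← (hcov hc).1 h0]
    exact (hiff.1 hc).hasDerivAt
  · intro h
    have hc := hiff.2 h.differentiableAt
    exact ⟨hc, (hcov hc).2 h.deriv⟩

end ParallelTransport

section PiecewiseCurve

variable {E : Type*} [NormedAddCommGroup E] [NormedSpace ℝ E]
  {H : Type*} [TopologicalSpace H] {I : ModelWithCorners ℝ E H}
  {M : Type*} [TopologicalSpace M] [ChartedSpace H M] {k : ℕ∞} {γ : ℝ → M}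

lemma Set.Finite.exists_ball_subset_compl_sdiff {S : Set ℝ} (hS : S.Finite) (t : ℝ) :
    ∃ δ > 0, Metric.ball t δ ⊆ (S \ {t})ᶜ :=
  Metric.isOpen_iff.1 (hS.subset sdiff_subset).isClosed.isOpen_compl t (by simp)

lemma IsPiecewiseContMDiff.exists_contMDiffOn_Icc_right (hγ : IsPiecewiseContMDiff I k γ) {t : ℝ}
    (ht : t ∈ Ico (0 : ℝ) 1) : ∃ b, t < b ∧ ContMDiffOn 𝓘(ℝ, ℝ) I k γ (Icc t b) := by
  obtain ⟨S, hS, hγS⟩ := hγ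
  obtain ⟨δ, hδ, hδS⟩ := hS.exists_ball_subset_compl_sdiff t
  have htb : t < min 1 (t + δ) := lt_min ht.2 (by linarith)
  refine ⟨min 1 (t + δ), htb, hγS t _ ht.1 htb (min_le_left _ _)
    (Set.disjoint_left.2 fun u hu huS ↦ hδS (Metric.mem_ball.2 ?_) ⟨huS, hu.1.ne'⟩)⟩
  rw [Real.dist_eq, abs_lt]
  constructor <;> linarith [hu.1, hu.2, min_le_right 1 (t + δ)]

lemma IsPiecewiseContMDiff.exists_contMDiffOn_Icc_left (hγ : IsPiecewiseContMDiff I k γ) {t : ℝ}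
    (ht : t ∈ Ioc (0 : ℝ) 1) : ∃ a, a < t ∧ ContMDiffOn 𝓘(ℝ, ℝ) I k γ (Icc a t) := by
  obtain ⟨S, hS, hγS⟩ := hγ
  obtain ⟨δ, hδ, hδS⟩ := hS.exists_ball_subset_compl_sdiff t
  have hat : max 0 (t - δ) < t := max_lt ht.1 (by linarith)
  refine ⟨max 0 (t - δ), hat, hγS _ t (le_max_left _ _) hat ht.2
    (Set.disjoint_left.2 fun u hu huS ↦ hδS (Metric.mem_ball.2 ?_) ⟨huS, hu.2.ne⟩)⟩
  rw [Real.dist_eq, abs_lt]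
  constructor <;> linarith [hu.1, hu.2, le_max_right 0 (t - δ)]

lemma IsPiecewiseContMDiff.continuousOn (hγ : IsPiecewiseContMDiff I k γ) :
    ContinuousOn γ (Icc 0 1) := by
  intro t ht
  have hl : ContinuousWithinAt γ (Icc 0 t) t := by
    rcases eq_or_lt_of_le ht.1 with rfl | h
    · simp
    · obtain ⟨a, hat, h⟩ := hγ.exists_contMDiffOn_Icc_left ⟨h, ht.2⟩
      refine (h.continuousOn t (right_mem_Icc.2 hat.le)).mono_of_mem_nhdsWithin ?_
      filter_upwards [self_mem_nhdsWithin, mem_nhdsWithin_of_mem_nhds (Ioi_mem_nhds hat)]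
        with u hu hu' using ⟨(mem_Ioi.1 hu').le, hu.2⟩
  have hr : ContinuousWithinAt γ (Icc t 1) t := by
    rcases eq_or_lt_of_le ht.2 with rfl | h
    · simp
    · obtain ⟨b, htb, h⟩ := hγ.exists_contMDiffOn_Icc_right ⟨ht.1, h⟩
      refine (h.continuousOn t (left_mem_Icc.2 htb.le)).mono_of_mem_nhdsWithin ?_
      filter_upwards [self_mem_nhdsWithin, mem_nhdsWithin_of_mem_nhds (Iio_mem_nhds htb)]
        with u hu hu' using ⟨hu.1, (mem_Iio.1 hu').le⟩
  rw [← Icc_union_Icc_eq_Icc ht.1 ht.2]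
  exact hl.union hr

lemma IsPiecewiseContMDiff.exists_finite_contMDiffAt (hγ : IsPiecewiseContMDiff I k γ) :
    ∃ S : Set ℝ, S.Finite ∧ ∀ t ∈ Ioo (0 : ℝ) 1 \ S, ContMDiffAt 𝓘(ℝ, ℝ) I k γ t := by
  obtain ⟨S, hS, hγS⟩ := hγ
  refine ⟨S, hS, fun t ⟨ht, htS⟩ ↦ ?_⟩
  obtain ⟨a, b, htab, hab⟩ := mem_nhds_iff_exists_Ioo_subset.1
    ((isOpen_Ioo.inter hS.isClosed.isOpen_compl).mem_nhds ⟨ht, htS⟩)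
  have ha := max_lt ht.1 htab.1
  have hb := lt_min ht.2 htab.2
  refine (hγS (max 0 a) (min 1 b) (le_max_left _ _) (ha.trans hb) (min_le_left _ _)
    (Set.disjoint_left.2 fun u hu ↦ (hab ⟨(le_max_right _ _).trans_lt hu.1,
      hu.2.trans_le (min_le_right _ _)⟩).2)).contMDiffAt (Icc_mem_nhds ha hb)

end PiecewiseCurve

section ParallelTransportExistence

variable {E : Type*} [NormedAddCommGroup E] [NormedSpace ℝ E] [FiniteDimensional ℝ E]
  {H : Type*} [TopologicalSpace H] {I : ModelWithCorners ℝ E H}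
  {M : Type*} [TopologicalSpace M] [ChartedSpace H M] [IsManifold I ∞ M]

/-- A connection on the tangent bundle with continuous connection coefficients. -/
def HasContinuousCoeff (cov : CovariantDerivative I E (TangentSpace I : M → Type _)) : Prop :=
  ∀ (x : M) (w ξ : E), ContinuousOn (fun y ↦
    connectionCoeff cov (trivializationAt E (TangentSpace I) x) y w ξ)
    (trivializationAt E (TangentSpace I : M → Type _) x).baseSet

lemma SmoothMetric.hasContinuousCoeff_leviCivita (g : SmoothMetric I M) :
    HasContinuousCoeff g.leviCivita := fun x w ξ ↦
  (g.continuousOn_leviCivita_trivialization (trivializationAt E (TangentSpace I) x) w ξ).congr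
    fun _ hy ↦ connectionCoeff_apply _ _ hy w ξ

variable {cov : CovariantDerivative I E (TangentSpace I : M → Type _)} {γ : ℝ → M}

/-- In a chart, the equation for parallel fields along a `C^1` curve is a linear ordinary
differential equation with continuous coefficients. -/
lemma HasContinuousCoeff.exists_parallel_ode (hcov : HasContinuousCoeff cov) {x : M} {a b : ℝ}
    (hab : a < b) (hγ : ContMDiffOn 𝓘(ℝ, ℝ) I 1 γ (Icc a b))
    (hx : ∀ t ∈ Icc a b, γ t ∈ (chartAt H x).source) :
    ∃ A : ℝ → E →L[ℝ] E, Continuous A ∧ ∀ c : ℝ → TangentBundle I M, ∀ t ∈ Ioo a b,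
      (∀ᶠ u in 𝓝 t, (c u).proj = γ u) →
      (IsParallelAt cov c t ↔ HasDerivAt (fun u ↦ (trivializationAt E (TangentSpace I) x (c u)).2)
        (A t (trivializationAt E (TangentSpace I) x (c t)).2) t) := by
  set e := trivializationAt E (TangentSpace I : M → Type _) x with he
  let q : ℝ → E := fun t ↦ extChartAt I x (γ t)
  have hq : ContDiffOn ℝ 1 q (Icc a b) :=
    ((contMDiffOn_extChartAt (I := I) (x := x) (n := 1)).comp hγ hx).contDiffOn
  have hq' : ContinuousOn (derivWithin q (Icc a b)) (Icc a b) :=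
    hq.continuousOn_derivWithin (uniqueDiffOn_Icc hab) le_rfl
  have hC (w : E) : ContinuousOn (fun t ↦ connectionCoeff cov e (γ t) w) (Icc a b) := by
    rw [continuousOn_clm_apply]
    exact fun ξ ↦ (hcov x w ξ).comp hγ.continuousOn hx
  let A₀ : ℝ → E →L[ℝ] E := fun t ↦ -∑ i,
    (LinearMap.toContinuousLinearMap ((Module.finBasis ℝ E).coord i)).smulRight
      (connectionCoeff cov e (γ t) (Module.finBasis ℝ E i) (derivWithin q (Icc a b) t))
  have hA₀ (t : ℝ) (ht : t ∈ Icc a b) (w : E) :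
      A₀ t w = -connectionCoeff cov e (γ t) w (derivWithin q (Icc a b) t) := by
    rw [connectionCoeff_eq_sum cov e (hx t ht) w]
    simp [A₀]
  have hA₀c : ContinuousOn A₀ (Icc a b) := by
    rw [continuousOn_clm_apply]
    intro w
    simp only [A₀, neg_apply, sum_apply, ContinuousLinearMap.smulRight_apply]
    exact (continuousOn_finsetSum _ fun i _ ↦
      ((hC (Module.finBasis ℝ E i)).clm_apply hq').const_smul _).neg
  refine ⟨IccExtend hab.le ((Icc a b).domRestrict A₀),
    (continuousOn_iff_continuous_domRestrict.1 hA₀c).Icc_extend', fun c t ht hc ↦ ?_⟩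
  have htI := Ioo_subset_Icc_self ht
  have hct : (c t).proj = γ t := hc.self_of_nhds
  have hγt : MDifferentiableAt 𝓘(ℝ, ℝ) I (fun u ↦ (c u).proj) t :=
    (((hγ t htI).contMDiffAt (Icc_mem_nhds ht.1 ht.2)).mdifferentiableAt
      (by simp)).congr_of_eventuallyEq hc
  have hd : deriv (fun u ↦ extChartAt I x (c u).proj) t = derivWithin q (Icc a b) t := by
    rw [derivWithin_of_mem_nhds (Icc_mem_nhds ht.1 ht.2)]
    exact Filter.EventuallyEq.deriv_eq (hc.mono fun u hu ↦ congrArg (extChartAt I x) hu)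
  rw [isParallelAt_iff_hasDerivAt cov x (by rw [hct]; exact hx t htI) hγt, hd,
    IccExtend_of_mem _ _ htI, domRestrict_apply, hA₀ t htI, hct]

/-- Parallel transport along `C^1` curves exists on short intervals. -/
lemma HasContinuousCoeff.exists_local_transport (hcov : HasContinuousCoeff cov) {a b t₀ : ℝ}
    (hab : a < b) (hγ : ContMDiffOn 𝓘(ℝ, ℝ) I 1 γ (Icc a b)) (ht₀ : t₀ ∈ Icc a b) :
    ∃ ε > 0, ∀ s ∈ Icc a b ∩ Ioo (t₀ - ε) (t₀ + ε), ∀ s' ∈ Icc a b ∩ Ioo (t₀ - ε) (t₀ + ε),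
      s ≤ s' → HasTransportOn cov γ s s' := by
  set x := γ t₀ with hxdef
  set e := trivializationAt E (TangentSpace I : M → Type _) x with he
  obtain ⟨δ, hδ, hδe⟩ := Metric.mem_nhdsWithin_iff.1 (hγ.continuousOn t₀ ht₀
    ((chartAt H x).open_source.mem_nhds (mem_chart_source H x)))
  set a' := max a (t₀ - δ / 2) with ha'
  set b' := min b (t₀ + δ / 2) with hb'
  have hab' : a' < b' := by
    rw [ha', hb', max_lt_iff, lt_min_iff, lt_min_iff]
    exact ⟨⟨hab, by linarith [ht₀.1]⟩, by linarith [ht₀.2], by linarith⟩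
  have hsub : Icc a' b' ⊆ Icc a b := Icc_subset_Icc (le_max_left _ _) (min_le_left _ _)
  have hx : ∀ t ∈ Icc a' b', γ t ∈ (chartAt H x).source := fun t ht ↦ by
    refine hδe ⟨?_, hsub ht⟩
    rw [Metric.mem_ball, Real.dist_eq, abs_lt]
    have h1 := (le_max_right a (t₀ - δ / 2)).trans ht.1
    have h2 := ht.2.trans (min_le_right b (t₀ + δ / 2))
    constructor <;> linarith
  have hbase : ∀ t ∈ Icc a' b', γ t ∈ e.baseSet := hx
  obtain ⟨A, hA, hpar⟩ := hcov.exists_parallel_ode hab' (hγ.mono hsub) hx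
  obtain ⟨ε₁, hε₁, Φ, Ψ, hΦ⟩ := exists_isFundamentalPair hA t₀
  refine ⟨min ε₁ (δ / 2), lt_min hε₁ (half_pos hδ), fun s hs s' hs' hss ↦ ?_⟩
  have hsub₁ : Icc s s' ⊆ Ioo (t₀ - ε₁) (t₀ + ε₁) := fun t ht ↦
    ⟨by linarith [hs.2.1, ht.1, min_le_left ε₁ (δ / 2)],
      by linarith [hs'.2.2, ht.2, min_le_left ε₁ (δ / 2)]⟩
  have hsub₂ : Icc s s' ⊆ Icc a' b' := fun t ht ↦
    ⟨max_le (hs.1.1.trans ht.1) (by linarith [hs.2.1, ht.1, min_le_right ε₁ (δ / 2)]),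
      le_min (ht.2.trans hs'.1.2) (by linarith [hs'.2.2, ht.2, min_le_right ε₁ (δ / 2)])⟩
  have hsub₃ : Ioo s s' ⊆ Ioo a' b' := fun t ht ↦
    ⟨(hsub₂ (left_mem_Icc.2 hss)).1.trans_lt ht.1, ht.2.trans_le (hsub₂ (right_mem_Icc.2 hss)).2⟩
  have hsI := left_mem_Icc.2 hss
  have hsI' := right_mem_Icc.2 hss
  have hcpl : CompleteSpace E := FiniteDimensional.complete ℝ E
  let ℓ (t : ℝ) (ht : t ∈ Icc s s') : TangentSpace I (γ t) ≃ₗ[ℝ] E :=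
    e.linearEquivAt ℝ (γ t) (hbase t (hsub₂ ht))
  have hℓ (t : ℝ) (ht : t ∈ Icc s s') (v : TangentSpace I (γ t)) : ℓ t ht v = (e ⟨γ t, v⟩).2 := rfl
  let m : E ≃ₗ[ℝ] E := LinearEquiv.ofLinearMap (Φ s' ∘L Ψ s : E →L[ℝ] E).toLinearMap
    (Φ s ∘L Ψ s' : E →L[ℝ] E).toLinearMap
    (LinearMap.ext fun v ↦ by
      simp [hΦ.inv_apply_apply _ (hsub₁ hsI), hΦ.apply_inv_apply _ (hsub₁ hsI')])
    (LinearMap.ext fun v ↦ by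
      simp [hΦ.inv_apply_apply _ (hsub₁ hsI'), hΦ.apply_inv_apply _ (hsub₁ hsI)])
  refine ⟨(ℓ s hsI).trans (m.trans (ℓ s' hsI').symm), fun v w ↦ ?_⟩
  rw [LinearEquiv.trans_apply, LinearEquiv.trans_apply, LinearEquiv.eq_symm_apply, hℓ s hsI,
    hℓ s' hsI']
  change _ ↔ _ = Φ s' (Ψ s _)
  constructor
  · rintro ⟨c, hc, ⟨S, hS, hp⟩, hpr, h0, h1⟩
    have hf : ContinuousOn (fun t ↦ (e (c t)).2) (Icc s s') := by
      refine continuous_snd.comp_continuousOn (e.continuousOn.comp hc fun u hu ↦ ?_)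
      rw [e.mem_source, hpr u hu]
      exact hbase u (hsub₂ hu)
    have h2 := (hΦ.mono hsub₁).eq_of_hasDerivAt hss hf hS.countable fun t ht ↦ by
      refine (hpar c t (hsub₃ ht.1) ?_).1 (hp t ht)
      filter_upwards [isOpen_Ioo.mem_nhds ht.1] with u hu using hpr u (Ioo_subset_Icc_self hu)
    rwa [h0, h1] at h2
  · intro hw
    let f : ℝ → E := fun t ↦ Φ t (Ψ s (e ⟨γ s, v⟩).2)
    have hfd : ∀ t ∈ Icc s s', HasDerivAt f (A t (f t)) t := fun t ht ↦
      ((hΦ.hasDerivAt t (hsub₁ ht)).clm_apply (hasDerivAt_const t _)).congr_deriv (by simp [f])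
    let c : ℝ → TangentBundle I M := fun t ↦ ⟨γ t, e.symm (γ t) (f t)⟩
    have hce : ∀ t ∈ Icc s s', (e (c t)).2 = f t := fun t ht ↦
      congrArg Prod.snd (e.apply_mk_symm (hbase t (hsub₂ ht)) (f t))
    refine ⟨c, ?_, ⟨∅, finite_empty, fun t ht ↦ ?_⟩, fun _ _ ↦ rfl, ?_, ?_⟩
    · exact e.continuousOn_symm.comp (((hγ.mono hsub).mono hsub₂).continuousOn.prodMk
          (HasDerivAt.continuousOn hfd)) fun t ht ↦ ⟨hbase t (hsub₂ ht), mem_univ _⟩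
    · refine (hpar c t (hsub₃ ht.1) (Filter.Eventually.of_forall fun _ ↦ rfl)).2 ?_
      have htI := Ioo_subset_Icc_self ht.1
      rw [hce t htI]
      refine (hfd t htI).congr_of_eventuallyEq ?_
      filter_upwards [isOpen_Ioo.mem_nhds ht.1] with u hu using hce u (Ioo_subset_Icc_self hu)
    · have h1 : f s = (e ⟨γ s, v⟩).2 := hΦ.apply_inv_apply _ (hsub₁ hsI) _
      exact congrArg (TotalSpace.mk (γ s)) ((congrArg (e.symm (γ s)) h1).trans
        (e.symm_apply_apply_mk (hbase s (hsub₂ hsI)) v))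
    · exact congrArg (TotalSpace.mk (γ s')) ((congrArg (e.symm (γ s')) hw.symm).trans
        (e.symm_apply_apply_mk (hbase s' (hsub₂ hsI')) w))

/-- Parallel transport along piecewise `C^1` curves exists. -/
lemma HasContinuousCoeff.hasTransportOn (hcov : HasContinuousCoeff cov) {k : ℕ∞} (hk : 1 ≤ k)
    (hγ : IsPiecewiseContMDiff I k γ) : HasTransportOn cov γ 0 1 := by
  have hk' : (1 : ℕ∞ω) ≤ k := by exact_mod_cast hk
  refine rel_zero_one_of_local (P := HasTransportOn cov γ) (.refl cov γ 0)
    (fun a b c hab hbc h₁ h₂ ↦ h₁.trans hab hbc h₂) (fun t ht ↦ ?_) fun t ht ↦ ?_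
  · obtain ⟨b, htb, hγb⟩ := hγ.exists_contMDiffOn_Icc_right ht
    obtain ⟨ε, hε, h⟩ := hcov.exists_local_transport htb (hγb.of_le hk') (left_mem_Icc.2 htb.le)
    refine ⟨min ε (b - t), lt_min hε (by linarith), fun s hs ↦ h t ⟨left_mem_Icc.2 htb.le,
      by linarith, by linarith⟩ s ⟨⟨hs.1.le, ?_⟩, by linarith [hs.1], ?_⟩ hs.1.le⟩
    · linarith [hs.2, min_le_right ε (b - t)]
    · linarith [hs.2, min_le_left ε (b - t)]
  · obtain ⟨a, hat, hγa⟩ := hγ.exists_contMDiffOn_Icc_left ht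
    obtain ⟨ε, hε, h⟩ := hcov.exists_local_transport hat (hγa.of_le hk') (right_mem_Icc.2 hat.le)
    refine ⟨min ε (t - a), lt_min hε (by linarith), fun s hs ↦ h s ⟨⟨?_, hs.2.le⟩, ?_,
      by linarith [hs.2]⟩ t ⟨right_mem_Icc.2 hat.le, by linarith, by linarith⟩ hs.2.le⟩
    · linarith [hs.1, min_le_right ε (t - a)]
    · linarith [hs.1, min_le_left ε (t - a)]

theorem HasContinuousCoeff.exists_isParallelTransport (hcov : HasContinuousCoeff cov) {k : ℕ∞}
    (hk : 1 ≤ k) {x : M} (hγ : IsPiecewiseLoop I k γ x) :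
    ∃ P : TangentSpace I x ≃ₗ[ℝ] TangentSpace I x, IsParallelTransport cov γ P := by
  obtain ⟨L, hL⟩ := hcov.hasTransportOn hk hγ.piecewise
  have key : ∀ y z, γ 0 = y → γ 1 = z →
      ∃ P : TangentSpace I y ≃ₗ[ℝ] TangentSpace I z, IsParallelTransport cov γ P := by
    rintro y z rfl rfl
    exact ⟨L, fun v w ↦ transportsOn_zero_one.symm.trans (hL v w)⟩
  exact key x x hγ.source hγ.target

end ParallelTransportExistence

section ConeConnection

variable {E : Type*} [NormedAddCommGroup E] [NormedSpace ℝ E]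
  {H : Type*} [TopologicalSpace H] {I : ModelWithCorners ℝ E H}
  {M : Type*} [TopologicalSpace M] [ChartedSpace H M] [IsManifold I ∞ M]

open VectorField in
lemma mlieBracket_extend [CompleteSpace E] {x : M} (v w : TangentSpace I x) :
    mlieBracket I (FiberBundle.extend E v) (FiberBundle.extend E w) x = 0 := by
  set e := trivializationAt E (TangentSpace I : M → Type _) x with he
  have key (v : TangentSpace I x) :
      mpullbackWithin 𝓘(ℝ, E) I (extChartAt I x).symm (FiberBundle.extend E v) (range I)
        =ᶠ[𝓝[range I] (extChartAt I x x)] fun _ ↦ (e ⟨x, v⟩).2 := by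
    filter_upwards [extChartAt_target_mem_nhdsWithin (I := I) x] with z hz
    have hy : (extChartAt I x).symm z ∈ e.baseSet := by
      have := (extChartAt I x).map_target hz
      rwa [extChartAt_source] at this
    have h1 := TangentBundle.symmL_trivializationAt (I := I) hy
    rw [(extChartAt I x).right_inv hz] at h1
    rw [mpullbackWithin_apply, ← h1]
    change (e.symmL ℝ _).inverse (e.symm ((extChartAt I x).symm z) (e ⟨x, v⟩).2) = _
    rw [← e.symmL_apply (R := ℝ) hy, ← e.symm_continuousLinearEquivAt_eq' (R := ℝ) hy,
      ContinuousLinearMap.inverse_equiv]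
    exact (e.continuousLinearEquivAt ℝ _ hy).apply_symm_apply _
  have hx : extChartAt I x x ∈ range I := by simp
  rw [← mlieBracketWithin_univ, mlieBracketWithin_apply, preimage_univ, univ_inter,
    (key v).lieBracketWithin_vectorField_eq_of_mem (key w) hx]
  simp only [lieBracketWithin, fderivWithin_fun_const, Pi.zero_apply, zero_apply, sub_self]
  exact map_zero _

namespace Cone

lemma trivializationAt_snd {p q : Cone M} (hq : q.1 ∈ (chartAt H p.1).source) (v : E × ℝ) :
    (trivializationAt (E × ℝ) (TangentSpace (I.prod 𝓘(ℝ, ℝ)) : Cone M → Type _) p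
      ⟨q, v⟩).2 = ((trivializationAt E (TangentSpace I : M → Type _) p.1 ⟨q.1, v.1⟩).2, v.2) := by
  have hq2 : q.2 ∈ (chartAt ℝ p.2).source := by
    rw [TopologicalSpace.Opens.chartAt_eq, OpenPartialHomeomorph.subtypeRestr_source]
    exact mem_univ _
  have hq' : q ∈ (chartAt (ModelProd H ℝ) p).source := ⟨hq, hq2⟩
  have h1 : mfderiv (I.prod 𝓘(ℝ, ℝ)) 𝓘(ℝ, E × ℝ) (extChartAt (I.prod 𝓘(ℝ, ℝ)) p) q
      = (mfderiv I 𝓘(ℝ, E) (extChartAt I p.1) q.1).prodMap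
        (mfderiv 𝓘(ℝ, ℝ) 𝓘(ℝ, ℝ) (extChartAt 𝓘(ℝ, ℝ) p.2) q.2) := by
    rw [← mfderiv_prodMap (mdifferentiableAt_extChartAt hq) (mdifferentiableAt_extChartAt hq2)]
    rw [extChartAt_prod, modelWithCornersSelf_prod, ← chartedSpaceSelf_prod]
    rfl
  have h2 : mfderiv 𝓘(ℝ, ℝ) 𝓘(ℝ, ℝ) (extChartAt 𝓘(ℝ, ℝ) p.2) q.2 = ContinuousLinearMap.id ℝ ℝ :=
    mfderiv_posReal q.2
  have h3 := TangentBundle.continuousLinearMapAt_trivializationAt (I := I.prod 𝓘(ℝ, ℝ)) hq'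
  have h4 := TangentBundle.continuousLinearMapAt_trivializationAt (I := I) hq
  rw [h1, h2, ← h4] at h3
  have h5 := congrArg (fun L : E × ℝ →L[ℝ] E × ℝ ↦ L v) h3
  have h6 := congrFun (Trivialization.coe_linearMapAt_of_mem (R := ℝ)
    (trivializationAt (E × ℝ) (TangentSpace (I.prod 𝓘(ℝ, ℝ)) : Cone M → Type _) p) hq') v
  have h7 := congrFun (Trivialization.coe_linearMapAt_of_mem (R := ℝ)
    (trivializationAt E (TangentSpace I : M → Type _) p.1) hq) v.1
  refine h6.symm.trans (h5.trans ?_)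
  exact Prod.ext h7 rfl

lemma trivializationAt_symm {p q : Cone M} (hq : q.1 ∈ (chartAt H p.1).source) (w : E × ℝ) :
    ((trivializationAt (E × ℝ) (TangentSpace (I.prod 𝓘(ℝ, ℝ)) : Cone M → Type _) p).symm q w : E × ℝ)
      = ((trivializationAt E (TangentSpace I : M → Type _) p.1).symm q.1 w.1, w.2) := by
  set e := trivializationAt (E × ℝ) (TangentSpace (I.prod 𝓘(ℝ, ℝ)) : Cone M → Type _) p
  have hq2 : q.2 ∈ (chartAt ℝ p.2).source := by
    rw [TopologicalSpace.Opens.chartAt_eq, OpenPartialHomeomorph.subtypeRestr_source]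
    exact mem_univ _
  have hq' : q ∈ e.baseSet := ⟨hq, hq2⟩
  set z : E × ℝ := ((trivializationAt E (TangentSpace I : M → Type _) p.1).symm q.1 w.1, w.2) with hz
  have h1 : (e ⟨q, z⟩).2 = w := by
    rw [trivializationAt_snd hq]
    refine Prod.ext ?_ rfl
    exact congrArg Prod.snd
      ((trivializationAt E (TangentSpace I : M → Type _) p.1).apply_mk_symm hq w.1)
  exact (congrArg (e.symm q) h1.symm).trans (e.symm_apply_apply_mk hq' z)

lemma extend_eq {p q : Cone M} (hq : q.1 ∈ (chartAt H p.1).source)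
    (v : TangentSpace (I.prod 𝓘(ℝ, ℝ)) p) :
    (FiberBundle.extend (E × ℝ) v q : E × ℝ)
      = (FiberBundle.extend E (dproj I p v) q.1, dradius I p v) := by
  set e := trivializationAt E (TangentSpace I : M → Type _) p.1
  have h := trivializationAt_snd (I := I) (mem_chart_source H p.1) (p := p) (q := p) v
  refine (trivializationAt_symm hq _).trans (Prod.ext (congrArg (e.symm q.1) ?_) ?_)
  · exact (congrArg Prod.fst h).trans
      (congrArg (fun X : E ↦ (e ⟨p.1, X⟩).2) (dproj_apply p v).symm)
  · exact (congrArg Prod.snd h).trans (dradius_apply p v).symm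

end Cone

lemma tangentPlusLine_trivializationAt_snd (x y : M) (v : E × ℝ) :
    (trivializationAt (E × ℝ) (TangentPlusLine I M) x ⟨y, v⟩).2
      = ((trivializationAt E (TangentSpace I : M → Type _) x ⟨y, v.1⟩).2, v.2) := rfl

lemma tangentPlusLine_trivializationAt_symm {x y : M} (hy : y ∈ (chartAt H x).source)
    (w : E × ℝ) :
    ((trivializationAt (E × ℝ) (TangentPlusLine I M) x).symm y w : E × ℝ)
      = ((trivializationAt E (TangentSpace I : M → Type _) x).symm y w.1, w.2) := by
  set e := trivializationAt (E × ℝ) (TangentPlusLine I M) x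
  have hy' : y ∈ e.baseSet := ⟨hy, mem_univ _⟩
  set z : E × ℝ := ((trivializationAt E (TangentSpace I : M → Type _) x).symm y w.1, w.2) with hz
  have h1 : (e ⟨y, z⟩).2 = w := by
    rw [tangentPlusLine_trivializationAt_snd]
    refine Prod.ext ?_ rfl
    exact congrArg Prod.snd
      ((trivializationAt E (TangentSpace I : M → Type _) x).apply_mk_symm hy w.1)
  exact (congrArg (e.symm y) h1.symm).trans (e.symm_apply_apply_mk hy' z)

lemma tangentPlusLine_extend_eq {x y : M} (hy : y ∈ (chartAt H x).source)
    (v : TangentPlusLine I M x) :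
    (FiberBundle.extend (E × ℝ) v y : E × ℝ) = (FiberBundle.extend E v.1 y, v.2) :=
  tangentPlusLine_trivializationAt_symm hy _

end ConeConnection

section ConeLeviCivita

variable {E : Type*} [NormedAddCommGroup E] [NormedSpace ℝ E]
  {H : Type*} [TopologicalSpace H] {I : ModelWithCorners ℝ E H}
  {M : Type*} [TopologicalSpace M] [ChartedSpace H M] [IsManifold I ∞ M]

lemma Cone.metricForm_eq_tangentIso (g : SmoothMetric I M) (p : Cone M)
    (v w : TangentSpace (I.prod 𝓘(ℝ, ℝ)) p) :
    Cone.metricForm g p v w = g.inner p.1 (Cone.tangentIso I p v).1 (Cone.tangentIso I p w).1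
      + (Cone.tangentIso I p v).2 * (Cone.tangentIso I p w).2 := by
  rw [Cone.metricForm_apply, Cone.tangentIso_apply, Cone.tangentIso_apply]
  simp only [map_smul, smul_apply, smul_eq_mul]
  ring

variable [FiniteDimensional ℝ E]

/-- The Koszul formula for coordinate vector fields. -/
lemma SmoothMetric.inner_leviCivita_extend (g : SmoothMetric I M) {x : M}
    (u v w : TangentSpace I x) :
    g.inner x (g.leviCivita (FiberBundle.extend E v) x u) w
      = 1 / 2 * (mvfderiv I (g.pair (FiberBundle.extend E v) (FiberBundle.extend E w)) x u
        + mvfderiv I (g.pair (FiberBundle.extend E u) (FiberBundle.extend E w)) x v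
        - mvfderiv I (g.pair (FiberBundle.extend E u) (FiberBundle.extend E v)) x w) := by
  have : CompleteSpace E := FiniteDimensional.complete ℝ E
  have h := g.inner_leviCivita (FiberBundle.mdifferentiableAt_extend I E u)
    (FiberBundle.mdifferentiableAt_extend I E v) (FiberBundle.mdifferentiableAt_extend I E w)
  simpa [koszul, mlieBracket_extend] using h

namespace Cone

lemma mvfderiv_pair_extend (g : SmoothMetric I M) {p : Cone M}
    (u v w : TangentSpace (I.prod 𝓘(ℝ, ℝ)) p) :
    mvfderiv (I.prod 𝓘(ℝ, ℝ)) ((metric g).pair (FiberBundle.extend (E × ℝ) v)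
        (FiberBundle.extend (E × ℝ) w)) p u
      = p.radius ^ 2 * mvfderiv I (g.pair (FiberBundle.extend E (dproj I p v))
          (FiberBundle.extend E (dproj I p w))) p.1 (dproj I p u)
        + 2 * p.radius * dradius I p u * g.inner p.1 (dproj I p v) (dproj I p w) := by
  set φ := g.pair (FiberBundle.extend E (dproj I p v)) (FiberBundle.extend E (dproj I p w)) with hφ
  have hφd : MDiffAt φ p.1 := g.mdifferentiableAt_pair (FiberBundle.mdifferentiableAt_extend I E _)
    (FiberBundle.mdifferentiableAt_extend I E _)
  have hφ1 : HasMFDerivAt (I.prod 𝓘(ℝ, ℝ)) 𝓘(ℝ, ℝ) (fun q : Cone M ↦ φ q.1) p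
      ((mfderiv I 𝓘(ℝ, ℝ) φ p.1).comp (dproj I p)) :=
    hφd.hasMFDerivAt.comp p mdifferentiableAt_fst.hasMFDerivAt
  have hr : MDifferentiableAt (I.prod 𝓘(ℝ, ℝ)) 𝓘(ℝ, ℝ) (radius : Cone M → ℝ) p :=
    (contMDiff_radius p).mdifferentiableAt (by simp)
  have hev : (metric g).pair (FiberBundle.extend (E × ℝ) v) (FiberBundle.extend (E × ℝ) w)
      =ᶠ[𝓝 p] fun q ↦ radius q * (radius q * φ q.1) + dradius I p v * dradius I p w := by
    have h : ∀ᶠ q : Cone M in 𝓝 p, q.1 ∈ (chartAt H p.1).source :=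
      continuous_fst.continuousAt.eventually
        ((chartAt H p.1).open_source.mem_nhds (mem_chart_source H p.1))
    filter_upwards [h] with q hq
    have h1 (v : TangentSpace (I.prod 𝓘(ℝ, ℝ)) p) :
        dproj I q (FiberBundle.extend (E × ℝ) v q) = FiberBundle.extend E (dproj I p v) q.1 :=
      (dproj_apply q _).trans (congrArg Prod.fst (extend_eq hq v))
    have h2 (v : TangentSpace (I.prod 𝓘(ℝ, ℝ)) p) :
        dradius I q (FiberBundle.extend (E × ℝ) v q) = dradius I p v :=
      (dradius_apply q _).trans (congrArg Prod.snd (extend_eq hq v))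
    change metricForm g q _ _ = _
    rw [metricForm_apply, h1, h1, h2, h2]
    simp only [φ, SmoothMetric.pair]
    ring
  have e1 : MDifferentiableAt (I.prod 𝓘(ℝ, ℝ)) 𝓘(ℝ, ℝ)
      (fun q : Cone M ↦ radius q * φ q.1) p := hr.mul hφ1.mdifferentiableAt
  have e1' : MDifferentiableAt (I.prod 𝓘(ℝ, ℝ)) 𝓘(ℝ, ℝ)
      (fun q : Cone M ↦ radius q * (radius q * φ q.1)) p := hr.mul e1
  have e2 : mvfderiv (I.prod 𝓘(ℝ, ℝ)) (fun q : Cone M ↦ φ q.1) p u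
      = mvfderiv I φ p.1 (dproj I p u) := congrArg (fun L : E × ℝ →L[ℝ] ℝ ↦ L u) hφ1.mfderiv
  have e3 : φ p.1 = g.inner p.1 (dproj I p v) (dproj I p w) := by simp [φ, SmoothMetric.pair]
  have e4 : mvfderiv (I.prod 𝓘(ℝ, ℝ)) ((metric g).pair (FiberBundle.extend (E × ℝ) v)
      (FiberBundle.extend (E × ℝ) w)) p
      = mvfderiv (I.prod 𝓘(ℝ, ℝ)) (fun q : Cone M ↦ radius q * (radius q * φ q.1)
        + dradius I p v * dradius I p w) p := by
    ext u
    exact congrArg (fun L : E × ℝ →L[ℝ] ℝ ↦ L u) hev.mfderiv_eq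
  rw [e4, mvfderiv_fun_add e1' mdifferentiableAt_const, mvfderiv_const, add_zero,
    mvfderiv_fun_mul hr e1, mvfderiv_fun_mul hr hφ1.mdifferentiableAt]
  simp only [add_apply, smul_apply, smul_eq_mul, e2, e3]
  change _ + _ * dradius I p u = _
  rw [show mvfderiv (I.prod 𝓘(ℝ, ℝ)) radius p u = dradius I p u from rfl]
  ring

/-- The Levi-Civita connection of the cone. -/
lemma tangentIso_leviCivita_extend (g : SmoothMetric I M) {p : Cone M}
    (u v : TangentSpace (I.prod 𝓘(ℝ, ℝ)) p) :
    tangentIso I p ((metric g).leviCivita (FiberBundle.extend (E × ℝ) v) p u)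
      = (p.radius • g.leviCivita (FiberBundle.extend E (dproj I p v)) p.1 (dproj I p u)
          + dradius I p v • dproj I p u + dradius I p u • dproj I p v,
        -(p.radius * g.inner p.1 (dproj I p v) (dproj I p u))) := by
  rw [← LinearEquiv.eq_symm_apply]
  refine (metric g).eq_of_inner_eq fun w ↦ ?_
  rw [(metric g).inner_leviCivita_extend]
  refine Eq.trans ?_ (metricForm_eq_tangentIso g p _ w).symm
  rw [LinearEquiv.apply_symm_apply, tangentIso_apply, mvfderiv_pair_extend, mvfderiv_pair_extend,
    mvfderiv_pair_extend]
  simp only [map_add, map_smul, add_apply, smul_apply, smul_eq_mul, g.inner_leviCivita_extend]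
  rw [g.symm p.1 (dproj I p v) (dproj I p u)]
  ring

end Cone

lemma rollingConnection_extend (g : SmoothMetric I M) {x : M} (v : TangentPlusLine I M x)
    (u : TangentSpace I x) :
    rollingConnection 1 g (FiberBundle.extend (E × ℝ) v) x u
      = (g.leviCivita (FiberBundle.extend E v.1) x u + v.2 • u, -g.inner x v.1 u) := by
  have hev : ∀ᶠ y in 𝓝 x, y ∈ (chartAt H x).source :=
    (chartAt H x).open_source.mem_nhds (mem_chart_source H x)
  have h0 : FiberBundle.extend (E × ℝ) v x = v := FiberBundle.extend_apply_self (E × ℝ) v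
  have hd := FiberBundle.mdifferentiableAt_extend I (E × ℝ) v
  have h1 : g.leviCivita (fun y ↦ (FiberBundle.extend (E × ℝ) v y).1) x
      = g.leviCivita (FiberBundle.extend E v.1) x := by
    refine g.leviCivita.isCovariantDerivativeOnUniv.congr_of_eventuallyEq
      (mdifferentiableAt_fst_section hd) (FiberBundle.mdifferentiableAt_extend I E v.1)
      Filter.univ_mem ?_
    filter_upwards [hev] with y hy using congrArg Prod.fst (tangentPlusLine_extend_eq hy v)
  have h2 : mvfderiv I (fun y ↦ ((FiberBundle.extend (E × ℝ) v y).2 : ℝ)) x u = 0 := by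
    have h3 : (fun y ↦ ((FiberBundle.extend (E × ℝ) v y).2 : ℝ)) =ᶠ[𝓝 x] fun _ ↦ v.2 := by
      filter_upwards [hev] with y hy
      have h := congrArg Prod.snd (tangentPlusLine_extend_eq hy v)
      exact h
    have h4 : mvfderiv I (fun _ : M ↦ (v.2 : ℝ)) x u = 0 := by rw [mvfderiv_const]; rfl
    exact (congrArg (fun L : E →L[ℝ] ℝ ↦ L u) h3.mfderiv_eq).trans h4
  change (g.leviCivita (fun y ↦ (FiberBundle.extend (E × ℝ) v y).1) x u
      + (FiberBundle.extend (E × ℝ) v x).2 • u,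
      mvfderiv I (fun y ↦ ((FiberBundle.extend (E × ℝ) v y).2 : ℝ)) x u
        - (1 : ℝ) * g.inner x (FiberBundle.extend (E × ℝ) v x).1 u) = _
  rw [h1, h2, h0, one_mul, zero_sub]

end ConeLeviCivita

section SMulExtend

variable {E : Type*} [NormedAddCommGroup E] [NormedSpace ℝ E]
  {H : Type*} [TopologicalSpace H] {I : ModelWithCorners ℝ E H}
  {M : Type*} [TopologicalSpace M] [ChartedSpace H M]
  {F : Type*} [NormedAddCommGroup F] [NormedSpace ℝ F]
  {V : M → Type*} [TopologicalSpace (TotalSpace F V)]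
  [∀ x, AddCommGroup (V x)] [∀ x, Module ℝ (V x)]

lemma Bundle.Trivialization.symm_smul (e : Trivialization F (π F V)) [e.IsLinear ℝ] {x : M}
    (hx : x ∈ e.baseSet) (a : ℝ) (w : F) : e.symm x (a • w) = a • e.symm x w := by
  rw [← e.symmₗ_apply (R := ℝ) hx, ← e.symmₗ_apply (R := ℝ) hx, map_smul]

lemma Bundle.Trivialization.symm_add (e : Trivialization F (π F V)) [e.IsLinear ℝ] {x : M}
    (hx : x ∈ e.baseSet) (w w' : F) : e.symm x (w + w') = e.symm x w + e.symm x w' := by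
  simp only [← e.symmₗ_apply (R := ℝ) hx, map_add]

lemma Bundle.Trivialization.apply_smul_snd (e : Trivialization F (π F V)) [e.IsLinear ℝ] {x : M}
    (hx : x ∈ e.baseSet) (a : ℝ) (v : V x) : (e ⟨x, a • v⟩).2 = a • (e ⟨x, v⟩).2 := by
  have h := congrFun (e.coe_linearMapAt_of_mem (R := ℝ) hx)
  exact (h _).symm.trans ((map_smul _ a v).trans (congrArg (a • ·) (h v)))

variable [∀ x, TopologicalSpace (V x)] [FiberBundle F V] [VectorBundle ℝ F V]
  [∀ x, IsTopologicalAddGroup (V x)] [∀ x, ContinuousSMul ℝ (V x)]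

lemma CovariantDerivative.extend_smul (cov : CovariantDerivative I F V) {x : M} (a : ℝ) (v : V x) :
    cov (FiberBundle.extend F (a • v)) x = a • cov (FiberBundle.extend F v) x := by
  have hv := FiberBundle.mdifferentiableAt_extend I F v
  rw [← cov.isCovariantDerivativeOnUniv.smul_const a hv]
  refine cov.isCovariantDerivativeOnUniv.congr_of_eventuallyEq
    (FiberBundle.mdifferentiableAt_extend I F _) (mdifferentiableAt_const.smul_section hv)
    Filter.univ_mem ?_
  set e := trivializationAt F V x
  filter_upwards [e.open_baseSet.mem_nhds (FiberBundle.mem_baseSet_trivializationAt' x)] with y hy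
  change e.symm y (e ⟨x, a • v⟩).2 = a • e.symm y (e ⟨x, v⟩).2
  rw [e.apply_smul_snd (FiberBundle.mem_baseSet_trivializationAt' x), e.symm_smul hy]

end SMulExtend

section ConeTransport

variable {E : Type*} [NormedAddCommGroup E] [NormedSpace ℝ E]
  {H : Type*} [TopologicalSpace H] {I : ModelWithCorners ℝ E H}
  {M : Type*} [TopologicalSpace M] [ChartedSpace H M]

namespace Cone

/-- The bundle map `T C(M) → TM ⊕ ℝ` given by `tangentIso`. -/
def toTangentPlusLine (z : TangentBundle (I.prod 𝓘(ℝ, ℝ)) (Cone M)) :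
    TotalSpace (E × ℝ) (TangentPlusLine I M) :=
  ⟨z.proj.1, tangentIso I z.proj z.2⟩

/-- The tangent vector to the cone over the given radius which `toTangentPlusLine` maps to the
given vector. -/
def ofTangentPlusLine (z : TotalSpace (E × ℝ) (TangentPlusLine I M)) (s : PosReal) :
    TangentBundle (I.prod 𝓘(ℝ, ℝ)) (Cone M) :=
  ⟨(z.proj, s), (tangentIso I (z.proj, s)).symm z.2⟩

lemma toTangentPlusLine_ofTangentPlusLine (z : TotalSpace (E × ℝ) (TangentPlusLine I M))
    (s : PosReal) : toTangentPlusLine (ofTangentPlusLine z s) = z :=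
  congrArg (TotalSpace.mk' (E × ℝ) z.proj) ((tangentIso I (z.proj, s)).apply_symm_apply z.2)

lemma ofTangentPlusLine_mk (p : Cone M) (v : TangentSpace (I.prod 𝓘(ℝ, ℝ)) p) :
    ofTangentPlusLine (TotalSpace.mk' (E × ℝ) p.1 (tangentIso I p v)) p.2
      = TotalSpace.mk' (E × ℝ) p v :=
  congrArg (TotalSpace.mk' (E × ℝ) p) ((tangentIso I p).symm_apply_apply v)

lemma velocity_proj {Γ : ℝ → Cone M} {t : ℝ}
    (hΓ : MDifferentiableAt 𝓘(ℝ, ℝ) (I.prod 𝓘(ℝ, ℝ)) Γ t) :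
    dproj I (Γ t) (velocity (I.prod 𝓘(ℝ, ℝ)) Γ t) = velocity I (fun u ↦ (Γ u).1) t := by
  have h := ((mdifferentiableAt_fst (I := I) (I' := 𝓘(ℝ, ℝ)) (M := M) (M' := PosReal)
    (x := Γ t)).hasMFDerivAt.comp t hΓ.hasMFDerivAt).mfderiv
  exact (congrArg (fun L : ℝ →L[ℝ] E ↦ L 1) h).symm

variable [IsManifold I ∞ M]

lemma trivializationAt_toTangentPlusLine {p : Cone M}
    {z : TangentBundle (I.prod 𝓘(ℝ, ℝ)) (Cone M)} (hz : z.proj.1 ∈ (chartAt H p.1).source) :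
    (trivializationAt (E × ℝ) (TangentPlusLine I M) p.1 (toTangentPlusLine z)).2
      = (z.proj.radius • (trivializationAt (E × ℝ)
          (TangentSpace (I.prod 𝓘(ℝ, ℝ)) : Cone M → Type _) p z).2.1,
        (trivializationAt (E × ℝ)
          (TangentSpace (I.prod 𝓘(ℝ, ℝ)) : Cone M → Type _) p z).2.2) := by
  set e := trivializationAt E (TangentSpace I : M → Type _) p.1
  have h := trivializationAt_snd (I := I) (p := p) (q := z.proj) hz z.2
  refine Prod.ext ?_ ?_
  · refine (e.apply_smul_snd hz _ _).trans (congrArg (z.proj.radius • ·) ?_)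
    exact (congrArg (fun X : E ↦ (e ⟨z.proj.1, X⟩).2) (dproj_apply z.proj z.2)).trans
      (congrArg Prod.fst h).symm
  · exact (dradius_apply z.proj z.2).trans (congrArg Prod.snd h).symm

lemma continuousWithinAt_toTangentPlusLine_iff
    {c : ℝ → TangentBundle (I.prod 𝓘(ℝ, ℝ)) (Cone M)} {s : Set ℝ} {t : ℝ}
    (hc : ContinuousWithinAt (fun u ↦ (c u).proj) s t) :
    ContinuousWithinAt (fun u ↦ toTangentPlusLine (c u)) s t ↔ ContinuousWithinAt c s t := by
  have h0 : ContinuousWithinAt (fun u ↦ (toTangentPlusLine (c u)).proj) s t :=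
    continuous_fst.continuousAt.comp_continuousWithinAt hc
  rw [FiberBundle.continuousWithinAt_totalSpace (E × ℝ) (fun u ↦ toTangentPlusLine (c u)),
    FiberBundle.continuousWithinAt_totalSpace (E × ℝ) c, and_iff_right hc, and_iff_right h0]
  set f := fun u ↦ (trivializationAt (E × ℝ)
    (TangentSpace (I.prod 𝓘(ℝ, ℝ)) : Cone M → Type _) (c t).proj (c u)).2
  have hr : ContinuousWithinAt (fun u ↦ (c u).proj.radius) s t :=
    (contMDiff_radius (I := I)).continuous.continuousAt.comp_continuousWithinAt hc
  have hev : ∀ᶠ u in 𝓝[s] t, (trivializationAt (E × ℝ) (TangentPlusLine I M) (c t).proj.1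
      (toTangentPlusLine (c u))).2 = ((c u).proj.radius • (f u).1, (f u).2) := by
    filter_upwards [(continuous_fst.continuousAt.comp_continuousWithinAt hc).eventually
      ((chartAt H (c t).proj.1).open_source.mem_nhds (mem_chart_source H _))] with u hu
    exact trivializationAt_toTangentPlusLine hu
  have ht := trivializationAt_toTangentPlusLine (I := I) (p := (c t).proj) (z := c t)
    (mem_chart_source H _)
  have h1 : ContinuousWithinAt (fun u ↦ (trivializationAt (E × ℝ) (TangentPlusLine I M)
      (c t).proj.1 (toTangentPlusLine (c u))).2) s t ↔
      ContinuousWithinAt (fun u ↦ ((c u).proj.radius • (f u).1, (f u).2)) s t :=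
    ⟨fun h ↦ h.congr_of_eventuallyEq (hev.mono fun _ h ↦ h.symm) ht.symm,
      fun h ↦ h.congr_of_eventuallyEq hev ht⟩
  refine Iff.trans h1 ⟨fun h ↦ ?_, fun h ↦ (hr.smul h.fst).prodMk h.snd⟩
  have h2 := ((hr.inv₀ (c t).proj.radius_pos.ne').smul h.fst).prodMk h.snd
  refine h2.congr (fun u _ ↦ ?_) ?_
  all_goals exact Prod.ext (inv_smul_smul₀ (radius_pos _).ne' _).symm rfl

variable [FiniteDimensional ℝ E]

/-- A vector field along a curve in the cone is parallel for the Levi-Civita connection if and only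
if the corresponding section of `TM ⊕ ℝ` is parallel for the rolling connection. -/
lemma isParallelAt_toTangentPlusLine_iff (g : SmoothMetric I M)
    {c : ℝ → TangentBundle (I.prod 𝓘(ℝ, ℝ)) (Cone M)} {t : ℝ}
    (hc : MDifferentiableAt 𝓘(ℝ, ℝ) (I.prod 𝓘(ℝ, ℝ)) (fun u ↦ (c u).proj) t) :
    IsParallelAt (rollingConnection 1 g) (fun u ↦ toTangentPlusLine (c u)) t ↔
      IsParallelAt (metric g).leviCivita c t := by
  set p := (c t).proj with hp
  set e := trivializationAt (E × ℝ) (TangentSpace (I.prod 𝓘(ℝ, ℝ)) : Cone M → Type _) p with he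
  set e' := trivializationAt (E × ℝ) (TangentPlusLine I M) p.1 with he'
  set f := fun u ↦ (e (c u)).2 with hf
  set f' := fun u ↦ (e' (toTangentPlusLine (c u))).2 with hf'
  set s := fun u ↦ (c u).proj.radius with hs
  have hsd : HasDerivAt s (dradius I p (velocity (I.prod 𝓘(ℝ, ℝ)) (fun u ↦ (c u).proj) t)) t :=
    hasDerivAt_comp_velocity (φ := (radius : Cone M → ℝ)) (γ := fun u ↦ (c u).proj)
      ((contMDiff_radius (I := I) p).mdifferentiableAt (by simp)) hc
  have hs0 (u : ℝ) : s u ≠ 0 := (radius_pos _).ne'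
  have hev : f' =ᶠ[𝓝 t] fun u ↦ (s u • (f u).1, (f u).2) := by
    filter_upwards [(continuous_fst.continuousAt.comp hc.continuousAt).eventually
      ((chartAt H p.1).open_source.mem_nhds (mem_chart_source H _))] with u hu
    exact trivializationAt_toTangentPlusLine hu
  have hdiff (hfd : DifferentiableAt ℝ f t) : HasDerivAt f'
      (s t • (deriv f t).1 + dradius I p (velocity (I.prod 𝓘(ℝ, ℝ)) (fun u ↦ (c u).proj) t)
        • (f t).1, (deriv f t).2) t := by
    have h1 : HasDerivAt (fun u ↦ (f u).1) (deriv f t).1 t :=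
      ((ContinuousLinearMap.fst ℝ E ℝ).hasFDerivAt.comp_hasDerivAt t hfd.hasDerivAt)
    have h2 : HasDerivAt (fun u ↦ (f u).2) (deriv f t).2 t :=
      ((ContinuousLinearMap.snd ℝ E ℝ).hasFDerivAt.comp_hasDerivAt t hfd.hasDerivAt)
    exact ((hsd.smul h1).prodMk h2).congr_of_eventuallyEq hev
  have hdiff' : DifferentiableAt ℝ f' t ↔ DifferentiableAt ℝ f t := by
    refine ⟨fun h ↦ ?_, fun h ↦ (hdiff h).differentiableAt⟩
    have h1 : DifferentiableAt ℝ (fun u ↦ (s u • (f u).1, (f u).2)) t :=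
      h.congr_of_eventuallyEq hev.symm
    refine ((hsd.differentiableAt.inv (hs0 t)).smul h1.fst |>.prodMk h1.snd).congr_of_eventuallyEq
      (Filter.Eventually.of_forall fun u ↦ ?_)
    exact Prod.ext (inv_smul_smul₀ (hs0 u) _).symm rfl
  have hbase : p ∈ e.baseSet := FiberBundle.mem_baseSet_trivializationAt' p
  have hM : MDifferentiableAt 𝓘(ℝ, ℝ) (I.prod 𝓘(ℝ, E × ℝ)) (fun u ↦ toTangentPlusLine (c u)) t ↔
      MDifferentiableAt 𝓘(ℝ, ℝ) ((I.prod 𝓘(ℝ, ℝ)).prod 𝓘(ℝ, E × ℝ)) c t := by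
    rw [mdifferentiableAt_totalSpace, mdifferentiableAt_totalSpace, and_iff_right hc]
    have h1 : MDifferentiableAt 𝓘(ℝ, ℝ) I (fun u ↦ (toTangentPlusLine (c u)).proj) t :=
      mdifferentiableAt_fst.comp t hc
    rw [and_iff_right h1]
    exact mdifferentiableAt_iff_differentiableAt.trans
      (hdiff'.trans mdifferentiableAt_iff_differentiableAt.symm)
  have hcov (hfd : DifferentiableAt ℝ f t) :
      covDerivAlong (rollingConnection 1 g) (fun u ↦ toTangentPlusLine (c u)) t
        = tangentIso I p (covDerivAlong (metric g).leviCivita c t) := by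
    set u := velocity (I.prod 𝓘(ℝ, ℝ)) (fun u ↦ (c u).proj) t with hu
    set v : TangentSpace (I.prod 𝓘(ℝ, ℝ)) p := (c t).2 with hv
    set ε := trivializationAt E (TangentSpace I : M → Type _) p.1 with hε
    have hx : p.1 ∈ ε.baseSet := FiberBundle.mem_baseSet_trivializationAt' p.1
    have hvel : velocity I (fun u ↦ (toTangentPlusLine (c u)).proj) t = dproj I p u :=
      (velocity_proj hc).symm
    have hd : deriv f' t = (s t • (deriv f t).1 + dradius I p u • (f t).1, (deriv f t).2) :=
      (hdiff hfd).deriv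
    have hft : ε.symm p.1 (f t).1 = dproj I p v := by
      have h1 : (f t).1 = (ε ⟨p.1, dproj I p v⟩).2 :=
        (congrArg Prod.fst (trivializationAt_snd (I := I) (p := p) (q := p)
          (mem_chart_source H p.1) v)).trans
          (congrArg (fun X : E ↦ (ε ⟨p.1, X⟩).2) (dproj_apply p v).symm)
      rw [h1]
      exact ε.symm_apply_apply_mk hx (dproj I p v)
    have e1 : (e'.symm p.1 (deriv f' t) : E × ℝ)
        = (s t • ε.symm p.1 (deriv f t).1 + dradius I p u • dproj I p v, (deriv f t).2) := by
      refine (tangentPlusLine_trivializationAt_symm (mem_chart_source H p.1) _).trans ?_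
      rw [hd, ε.symm_add hx, ε.symm_smul hx, ε.symm_smul hx, hft]
    have e2 : tangentIso I p (e.symm p (deriv f t))
        = (s t • ε.symm p.1 (deriv f t).1, (deriv f t).2) := by
      have h1 : (e.symm p (deriv f t) : E × ℝ) = (ε.symm p.1 (deriv f t).1, (deriv f t).2) :=
        trivializationAt_symm (I := I) (p := p) (q := p) (mem_chart_source H p.1) (deriv f t)
      refine Prod.ext ?_ ?_
      · exact congrArg (fun X : E ↦ s t • X)
          ((dproj_apply p (e.symm p (deriv f t) : E × ℝ)).trans (congrArg Prod.fst h1))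
      · have h2 := congrArg (fun z : E × ℝ ↦ z.2) h1
        exact (dradius_apply p (e.symm p (deriv f t) : E × ℝ)).trans h2
    have e3 := rollingConnection_extend g (tangentIso I p v) (dproj I p u)
    have e4 := tangentIso_leviCivita_extend g u v
    have e5 : g.leviCivita (FiberBundle.extend E (s t • dproj I p v)) p.1
        = s t • g.leviCivita (FiberBundle.extend E (dproj I p v)) p.1 :=
      g.leviCivita.extend_smul (s t) (dproj I p v)
    change e'.symm p.1 (deriv f' t) + rollingConnection 1 g
      (FiberBundle.extend (E × ℝ) (tangentIso I p v)) p.1 _ = tangentIso I p (e.symm p (deriv f t)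
        + (metric g).leviCivita (FiberBundle.extend (E × ℝ) v) p u)
    rw [map_add, e2, e4, hvel, e3]
    have e6 : g.leviCivita (FiberBundle.extend E (tangentIso I p v).1) p.1 (dproj I p u)
        = s t • g.leviCivita (FiberBundle.extend E (dproj I p v)) p.1 (dproj I p u) :=
      congrArg (fun L : E →L[ℝ] E ↦ L (dproj I p u)) e5
    have e7 : g.inner p.1 (tangentIso I p v).1 (dproj I p u)
        = s t * g.inner p.1 (dproj I p v) (dproj I p u) :=
      congrArg (fun L : E →L[ℝ] ℝ ↦ L (dproj I p u)) ((g.inner p.1).map_smul (s t) (dproj I p v))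
    rw [e6, e7]
    refine (congrArg (fun z : E × ℝ ↦ z + _) e1).trans ?_
    have key (A X Y D : E) (a b d q : ℝ) : ((A + b • X, d) : E × ℝ) + (D + a • Y, q)
        = (A, d) + (D + a • Y + b • X, q) :=
      Prod.ext (by simp only [Prod.fst_add]; abel) rfl
    exact key ..
  rw [IsParallelAt, IsParallelAt, hM]
  refine and_congr_right fun h ↦ ?_
  rw [hcov ((mdifferentiableAt_totalSpace _ c).1 h).2.differentiableAt]
  exact (tangentIso I p).map_eq_zero_iff

end Cone

end ConeTransport

section ConeHolonomy

variable {E : Type*} [NormedAddCommGroup E] [NormedSpace ℝ E]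
  {H : Type*} [TopologicalSpace H] {I : ModelWithCorners ℝ E H}
  {M : Type*} [TopologicalSpace M] [ChartedSpace H M]

namespace Cone

lemma isPiecewiseLoop_fst {k : ℕ∞} {Γ : ℝ → Cone M} {p : Cone M}
    (hΓ : IsPiecewiseLoop (I.prod 𝓘(ℝ, ℝ)) k Γ p) :
    IsPiecewiseLoop I k (fun t ↦ (Γ t).1) p.1 := by
  obtain ⟨⟨S, hS, h⟩, h0, h1⟩ := hΓ
  exact ⟨⟨S, hS, fun a b ha hab hb hd ↦ contMDiff_fst.comp_contMDiffOn (h a b ha hab hb hd)⟩,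
    congrArg Prod.fst h0, congrArg Prod.fst h1⟩

lemma isPiecewiseLoop_prodMk_const {k : ℕ∞} {γ : ℝ → M} {p : Cone M}
    (hγ : IsPiecewiseLoop I k γ p.1) :
    IsPiecewiseLoop (I.prod 𝓘(ℝ, ℝ)) k (fun t ↦ ((γ t, p.2) : Cone M)) p := by
  obtain ⟨⟨S, hS, h⟩, h0, h1⟩ := hγ
  exact ⟨⟨S, hS, fun a b ha hab hb hd ↦ (h a b ha hab hb hd).prodMk contMDiffOn_const⟩,
    Prod.ext h0 rfl, Prod.ext h1 rfl⟩

/-- Conjugation by `tangentIso`. -/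
def conjTangentIso (I : ModelWithCorners ℝ E H) (p : Cone M) :
    (TangentSpace (I.prod 𝓘(ℝ, ℝ)) p ≃ₗ[ℝ] TangentSpace (I.prod 𝓘(ℝ, ℝ)) p) ≃*
      (TangentPlusLine I M p.1 ≃ₗ[ℝ] TangentPlusLine I M p.1) where
  toFun A := (tangentIso I p).symm.trans (A.trans (tangentIso I p))
  invFun B := (tangentIso I p).trans (B.trans (tangentIso I p).symm)
  left_inv A := LinearEquiv.ext fun v ↦ by simp
  right_inv B := LinearEquiv.ext fun v ↦ by simp
  map_mul' A B := LinearEquiv.ext fun v ↦ by simp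

lemma conjTangentIso_apply_tangentIso (p : Cone M)
    (A : TangentSpace (I.prod 𝓘(ℝ, ℝ)) p ≃ₗ[ℝ] TangentSpace (I.prod 𝓘(ℝ, ℝ)) p)
    (v : TangentSpace (I.prod 𝓘(ℝ, ℝ)) p) :
    conjTangentIso I p A (tangentIso I p v) = tangentIso I p (A v) := by
  simp [conjTangentIso]

variable [IsManifold I ∞ M] [FiniteDimensional ℝ E]

/-- Along a piecewise `C^k` loop in the cone, `tangentIso` intertwines parallel transport for the
Levi-Civita connection of the cone with parallel transport for the rolling connection. -/
lemma transports_tangentIso_iff (g : SmoothMetric I M) {k : ℕ∞} (hk : 1 ≤ k) {Γ : ℝ → Cone M}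
    {p : Cone M} (hΓ : IsPiecewiseLoop (I.prod 𝓘(ℝ, ℝ)) k Γ p)
    (v w : TangentSpace (I.prod 𝓘(ℝ, ℝ)) p) :
    Transports (rollingConnection 1 g) (fun t ↦ (Γ t).1) (tangentIso I p v) (tangentIso I p w) ↔
      Transports (metric g).leviCivita Γ v w := by
  constructor
  · rintro ⟨c, ⟨hc, S, hS, hpar⟩, hpr, h0, h1⟩
    obtain ⟨S', hS', hd⟩ := hΓ.piecewise.exists_finite_contMDiffAt
    set c' := fun t ↦ ofTangentPlusLine (I := I) (c t) (Γ t).2 with hc'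
    have hcc : (fun t ↦ toTangentPlusLine (c' t)) = c :=
      funext fun t ↦ toTangentPlusLine_ofTangentPlusLine (c t) (Γ t).2
    have hpr' : EqOn (fun t ↦ (c' t).proj) Γ (Icc 0 1) := fun t ht ↦ Prod.ext (hpr t ht) rfl
    refine ⟨c', ⟨fun t ht ↦ ?_, S ∪ S', hS.union hS', fun t ht ↦ ?_⟩, hpr', ?_, ?_⟩
    · refine (continuousWithinAt_toTangentPlusLine_iff
        ((hΓ.piecewise.continuousOn.congr hpr') t ht)).1 ?_
      rw [hcc]
      exact hc t ht
    · refine (isParallelAt_toTangentPlusLine_iff g ?_).1 ?_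
      · refine ((hd t ⟨ht.1, fun h ↦ ht.2 (Or.inr h)⟩).mdifferentiableAt
          ?_).congr_of_eventuallyEq ?_
        · exact fun h ↦ (one_ne_zero : (1 : ℕ∞) ≠ 0)
            (nonpos_iff_eq_zero.1 (hk.trans_eq (by exact_mod_cast h)))
        · filter_upwards [isOpen_Ioo.mem_nhds ht.1] with u hu using hpr' (Ioo_subset_Icc_self hu)
      · rw [hcc]
        exact hpar t ⟨ht.1, fun h ↦ ht.2 (Or.inl h)⟩
    · rw [← ofTangentPlusLine_mk p v, ← h0, ← hΓ.source]
    · rw [← ofTangentPlusLine_mk p w, ← h1, ← hΓ.target]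
  · rintro ⟨c, ⟨hc, S, hS, hpar⟩, hpr, h0, h1⟩
    refine ⟨fun t ↦ toTangentPlusLine (c t), ⟨fun t ht ↦ ?_, S, hS, fun t ht ↦ ?_⟩,
      fun t ht ↦ congrArg Prod.fst (hpr t ht), ?_, ?_⟩
    · refine (continuousWithinAt_toTangentPlusLine_iff ?_).2 (hc t ht)
      exact (hΓ.piecewise.continuousOn.congr hpr) t ht
    · exact (isParallelAt_toTangentPlusLine_iff g
        ((mdifferentiableAt_totalSpace _ c).1 (hpar t ht).1).1).2 (hpar t ht)
    · exact congrArg toTangentPlusLine h0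
    · exact congrArg toTangentPlusLine h1

lemma isParallelTransport_conjTangentIso_iff (g : SmoothMetric I M) {k : ℕ∞} (hk : 1 ≤ k)
    {Γ : ℝ → Cone M} {p : Cone M} (hΓ : IsPiecewiseLoop (I.prod 𝓘(ℝ, ℝ)) k Γ p)
    (A : TangentSpace (I.prod 𝓘(ℝ, ℝ)) p ≃ₗ[ℝ] TangentSpace (I.prod 𝓘(ℝ, ℝ)) p) :
    IsParallelTransport (rollingConnection 1 g) (fun t ↦ (Γ t).1) (conjTangentIso I p A) ↔
      IsParallelTransport (metric g).leviCivita Γ A := by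
  rw [IsParallelTransport, IsParallelTransport, (tangentIso I p).surjective.forall]
  refine forall_congr' fun v ↦ ?_
  rw [(tangentIso I p).surjective.forall]
  refine forall_congr' fun w ↦ ?_
  rw [transports_tangentIso_iff g hk hΓ, conjTangentIso_apply_tangentIso,
    (tangentIso I p).injective.eq_iff]

lemma map_holonomyGroup (g : SmoothMetric I M) {k : ℕ∞} (hk : 1 ≤ k) (p : Cone M) :
    (holonomyGroup k (metric g).leviCivita p).map (conjTangentIso I p).toMonoidHom
      = holonomyGroup k (rollingConnection 1 g) p.1 := by
  ext B
  constructor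
  · rintro ⟨A, ⟨Γ, hΓ, hA⟩, rfl⟩
    exact ⟨_, isPiecewiseLoop_fst hΓ, (isParallelTransport_conjTangentIso_iff g hk hΓ A).2 hA⟩
  · rintro ⟨γ, hγ, hB⟩
    obtain ⟨A, rfl⟩ := (conjTangentIso I p).surjective B
    have hΓ := isPiecewiseLoop_prodMk_const hγ
    exact ⟨A, ⟨_, hΓ, (isParallelTransport_conjTangentIso_iff g hk hΓ A).1 hB⟩, rfl⟩

end Cone

end ConeHolonomy
end

theorem mainTheorem1 {E : Type*} [NormedAddCommGroup E] [NormedSpace ℝ E] [FiniteDimensional ℝ E]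
    {H : Type*} [TopologicalSpace H] (I : ModelWithCorners ℝ E H) [I.Boundaryless]
    {M : Type*} [TopologicalSpace M] [T2Space M] [SecondCountableTopology M]
    [ChartedSpace H M] [IsManifold I ∞ M]
    (g : SmoothMetric I M) (k : ℕ∞) (hk : 1 ≤ k) (p : Cone M) :
    (∃ φ : holonomyGroup k (Cone.metric g).leviCivita p ≃*
        holonomyGroup k (rollingConnection 1 g) p.1,
      ∀ (A : holonomyGroup k (Cone.metric g).leviCivita p) (v : TangentSpace (I.prod 𝓘(ℝ, ℝ)) p),
        (φ A).1 (Cone.tangentIso I p v) = Cone.tangentIso I p (A.1 v)) ∧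
    ∀ (γ : ℝ → M) (a : ℝ → PosReal),
      IsPiecewiseLoop (I.prod 𝓘(ℝ, ℝ)) k (fun t ↦ ((γ t, a t) : Cone M)) p →
      ∃ (P' : TangentSpace (I.prod 𝓘(ℝ, ℝ)) p ≃ₗ[ℝ] TangentSpace (I.prod 𝓘(ℝ, ℝ)) p)
        (P : TangentPlusLine I M p.1 ≃ₗ[ℝ] TangentPlusLine I M p.1),
        IsParallelTransport (Cone.metric g).leviCivita (fun t ↦ ((γ t, a t) : Cone M)) P' ∧
        IsParallelTransport (rollingConnection 1 g) γ P ∧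
        ∀ v : TangentSpace (I.prod 𝓘(ℝ, ℝ)) p,
          Cone.tangentIso I p (P' v) = P (Cone.tangentIso I p v) := by
  constructor
  · refine ⟨((Cone.conjTangentIso I p).subgroupMap _).trans
      (MulEquiv.subgroupCongr (Cone.map_holonomyGroup g hk p)), fun A v ↦ ?_⟩
    exact Cone.conjTangentIso_apply_tangentIso p A.1 v
  · intro γ a hΓ
    obtain ⟨P', hP'⟩ := (Cone.metric g).hasContinuousCoeff_leviCivita.exists_isParallelTransport
      hk hΓ
    exact ⟨P', Cone.conjTangentIso I p P', hP',
      (Cone.isParallelTransport_conjTangentIso_iff g hk hΓ P').2 hP',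
      fun v ↦ (Cone.conjTangentIso_apply_tangentIso p P' v).symm⟩
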